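/- Let $(\mathsf V,\otimes,\mathbb 1)$ be a closed symmetric monoidal category with small coproducts (for instance chain complexes over a field of characteristic $0$, or sets). An orthogonal category $\mathsf C^{\perp}$ is a small category $\mathsf C$ with a set $\perp$ of pairs $(f,g)$ of morphisms with common codomain which is symmetric and stable under post- and precomposition. Its AQFT operad $\mathcal O_{\mathsf C}^{\perp}$ is the coloured symmetric operad with set of colours $\mathrm{ob}\,\mathsf C$ generated by a unary operation $f\colon U\to V$ for each morphism $f$ of $\mathsf C$, and a binary operation $\mu_V$ and a nullary operation $1_V$ for each object $V$, subject to the following relations: functoriality in $\mathsf C$; associativity and unitality of $(\mu_V,1_V)$; $f\circ\mu_U=\mu_V\circ(f,f)$ and $f\circ 1_U=1_V$ for each $f\colon U\to V$ (together, these present the Boardman--Vogt tensor product $\mathsf C\otimes_{\mathrm{BV}}\mathsf{uAss}$); and $\mu_V\circ(f,g)=\mu_V^{\mathrm{op}}\circ(f,g)$ for all $f\perp g$ with codomain $V$. It is viewed as an operad in $\mathsf V$ through $X\mapsto\coprod_X\mathbb 1$. Let $S$ be a set of morphisms of $\mathsf C$, let $\mathsf C\to\mathsf C_S$ be the localization of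 $\mathsf C$ at $S$, and let $\perp_S$ be the pushforward orthogonality relation, i.e. the smallest orthogonality relation on $\mathsf C_S$ containing the images of all pairs in $\perp$. The $\mathsf{Set}$-localization $L\colon\mathcal O\to\mathcal O_S$ of an operad $\mathcal O$ at a set $S$ of unary operations is the universal morphism of operads sending every operation in $S$ to an invertible unary operation: each morphism of operads $\mathcal O\to\mathcal P$ which inverts $S$ factors uniquely through $L$. **Proposition.** The canonical morphism $\ell\colon\mathcal O_{\mathsf C}^{\perp}\to\mathcal O_{\mathsf C_S}^{\perp_S}$ sends $S$ to invertible operations and is itself a $\mathsf{Set}$-localization of $\mathcal O_{\mathsf C}^{\perp}$ at $S$ in operads in $\mathsf V$. Equivalently, for every $\mathsf{Set}$-localization $L\colon\mathcal O_{\mathsf C}^{\perp}\to(\mathcal O_{\mathsf C}^{\perp})_S$, the unique morphism $(\mathcal O_{\mathsf C}^{\perp})_S\to\mathcal O_{\mathsf C_S}^{\perp_S}$ compatible with $L$ and $\ell$ is an isomorphism of operads. -/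

import Mathlib

open CategoryTheory MonoidalCategory Limits

universe w v u v' u'

set_option linter.unusedSectionVars false
set_option linter.checkUnivs false

namespace AQFT

/-! ### Coloured symmetric operads, with partial compositions -/

/-- The data needed to form a partial composite `o ∘ᵢ p` of an operation `o` with input colours `c`
and an operation `p` with input colours `b` and output colour `x`: an input `pos` of `o` of
colour `x`, and a numbering by `Fin k` of the inputs of the composite, that is of the inputs of `o`
other than `pos` together with the inputs of `p`; `a` lists the colours of the inputs of
the composite in that numbering. All numberings are allowed, not only the order-preserving one. -/
structure Graft {K : Type u} {n m k : ℕ} (c : Fin n → K) (x : K) (b : Fin m → K)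
    (a : Fin k → K) where
  pos : Fin n
  pos_col : c pos = x
  num : {j : Fin n // j ≠ pos} ⊕ Fin m ≃ Fin k
  outer_col : ∀ j, a (num (Sum.inl j)) = c j
  inner_col : ∀ j, a (num (Sum.inr j)) = b j

namespace Graft

variable {K : Type u} {L : Type v}

/-- The number, in the composite, of the input `j ≠ pos` of the outer operation. -/
def outer {n m k : ℕ} {c : Fin n → K} {x : K} {b : Fin m → K} {a : Fin k → K}
    (g : Graft c x b a) (j : Fin n) (hj : j ≠ g.pos) : Fin k :=
  g.num (Sum.inl ⟨j, hj⟩)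

/-- The number, in the composite, of the input `j` of the inner operation. -/
def inner {n m k : ℕ} {c : Fin n → K} {x : K} {b : Fin m → K} {a : Fin k → K}
    (g : Graft c x b a) (j : Fin m) : Fin k :=
  g.num (Sum.inr j)

/-- Change of colours. -/
def map (φ : K → L) {n m k : ℕ} {c : Fin n → K} {x : K} {b : Fin m → K} {a : Fin k → K}
    (g : Graft c x b a) :
    Graft (fun i => φ (c i)) (φ x) (fun i => φ (b i)) (fun i => φ (a i)) where
  pos := g.pos
  pos_col := congrArg φ g.pos_col
  num := g.num
  outer_col j := congrArg φ (g.outer_col j)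
  inner_col j := congrArg φ (g.inner_col j)

/-- Composition of unary operations. -/
def unary (x y : K) :
    Graft (fun _ : Fin 1 => y) y (fun _ : Fin 1 => x) (fun _ : Fin 1 => x) where
  pos := 0
  pos_col := rfl
  num :=
    haveI : IsEmpty {j : Fin 1 // j ≠ 0} := ⟨fun j => j.2 (Subsingleton.elim _ _)⟩
    Equiv.emptySum _ _
  outer_col j := absurd (Subsingleton.elim _ _) j.2
  inner_col _ := rfl

/-- `(o ∘ p) ∘ q` (by `g`, then `g'`) and `o ∘ (p ∘ q)` (by `h`, then `h'`), where `q` is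
plugged into an input of `p`, have the same numbering of inputs. -/
def Sequential {n m l k r s : ℕ} {c : Fin n → K} {b : Fin m → K} {e : Fin l → K}
    {x y : K} {a : Fin k → K} {a' : Fin r → K} {t : Fin s → K}
    (g : Graft c x b a) (g' : Graft a y e a') (h : Graft b y e t) (h' : Graft c x t a') : Prop :=
  g'.pos = g.inner h.pos ∧ h'.pos = g.pos ∧
  (∀ j hj hj₁ hj₂, g'.outer (g.outer j hj) hj₁ = h'.outer j hj₂) ∧
  (∀ j hj hj₁, g'.outer (g.inner j) hj₁ = h'.inner (h.outer j hj)) ∧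
  (∀ j, g'.inner j = h'.inner (h.inner j))

/-- `(o ∘ p) ∘ q` (by `g`, then `g'`) and `(o ∘ q) ∘ p` (by `h`, then `h'`), where `p` and `q` are
plugged into different inputs of `o`, have the same numbering of inputs. -/
def Parallel {n m l k r s : ℕ} {c : Fin n → K} {b : Fin m → K} {e : Fin l → K}
    {x y : K} {a : Fin k → K} {a' : Fin r → K} {t : Fin s → K}
    (g : Graft c x b a) (g' : Graft a y e a') (h : Graft c y e t) (h' : Graft t x b a') : Prop :=
  (∃ hne, g'.pos = g.outer h.pos hne) ∧ (∃ hne, h'.pos = h.outer g.pos hne) ∧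
  (∀ j hj hj₁ hj₂ hj₃, g'.outer (g.outer j hj) hj₁ = h'.outer (h.outer j hj₂) hj₃) ∧
  (∀ j hj, g'.outer (g.inner j) hj = h'.inner j) ∧
  (∀ j hj, g'.inner j = h'.outer (h.inner j) hj)

/-- In a binary operation, a first unary operation (by `h`) is plugged into the input `i`, then
a second one (by `h'`) into the other input `j`; the inputs of the result are numbered
so that the input of the first unary operation is `0` and the input of the second one is `1`. -/
def PlugBoth {d x y : K} {r a : Fin 2 → K}
    (h : Graft (fun _ : Fin 2 => d) d (fun _ : Fin 1 => x) r)
    (h' : Graft r d (fun _ : Fin 1 => y) a) (i j : Fin 2) : Prop :=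
  h.pos = i ∧ (∃ hj, h'.pos = h.outer j hj) ∧ (∃ hne, h'.outer (h.inner 0) hne = 0) ∧
  h'.inner 0 = 1

end Graft

/-- A coloured symmetric operad in sets. The composites are indexed by `Graft`, hence come
with an arbitrary numbering of their inputs; the permutation action on the operations is
composition with an identity, `one d ∘ o`, with a new numbering of the inputs of `o`, and
equivariance is part of the two associativity laws. -/
structure SetOperad where
  Col : Type u
  Op : {n : ℕ} → (Fin n → Col) → Col → Type w
  one (x : Col) : Op (fun _ : Fin 1 => x) x
  comp {n m k : ℕ} {c : Fin n → Col} {x : Col} {b : Fin m → Col} {a : Fin k → Col} {d : Col}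
    (g : Graft c x b a) : Op c d → Op b x → Op a d
  one_comp {m : ℕ} {x : Col} {b : Fin m → Col} (g : Graft (fun _ : Fin 1 => x) x b b)
    (hg : ∀ j, g.inner j = j) (p : Op b x) : comp g (one x) p = p
  comp_one {n : ℕ} {c : Fin n → Col} {x d : Col} (g : Graft c x (fun _ : Fin 1 => x) c)
    (hg : ∀ j hj, g.outer j hj = j) (hg' : g.inner 0 = g.pos) (o : Op c d) :
    comp g o (one x) = o
  sequential {n m l k r s : ℕ} {c : Fin n → Col} {b : Fin m → Col} {e : Fin l → Col}
    {x y : Col} {a : Fin k → Col} {a' : Fin r → Col} {t : Fin s → Col} {d : Col}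
    (g : Graft c x b a) (g' : Graft a y e a') (h : Graft b y e t) (h' : Graft c x t a')
    (H : g.Sequential g' h h') (o : Op c d) (p : Op b x) (q : Op e y) :
    comp g' (comp g o p) q = comp h' o (comp h p q)
  parallel {n m l k r s : ℕ} {c : Fin n → Col} {b : Fin m → Col} {e : Fin l → Col}
    {x y : Col} {a : Fin k → Col} {a' : Fin r → Col} {t : Fin s → Col} {d : Col}
    (g : Graft c x b a) (g' : Graft a y e a') (h : Graft c y e t) (h' : Graft t x b a')
    (H : g.Parallel g' h h') (o : Op c d) (p : Op b x) (q : Op e y) :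
    comp g' (comp g o p) q = comp h' (comp h o q) p

/-- Morphisms of coloured symmetric operads in sets. -/
structure SetOperad.Hom (O : SetOperad.{w, u}) (P : SetOperad.{w, u}) where
  col : O.Col → P.Col
  op {n : ℕ} {c : Fin n → O.Col} {d : O.Col} : O.Op c d → P.Op (fun i => col (c i)) (col d)
  map_one (x : O.Col) : op (O.one x) = P.one (col x)
  map_comp {n m k : ℕ} {c : Fin n → O.Col} {x : O.Col} {b : Fin m → O.Col} {a : Fin k → O.Col}
    {d : O.Col} (g : Graft c x b a) (o : O.Op c d) (p : O.Op b x) :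
    op (O.comp g o p) = P.comp (g.map col) (op o) (op p)

section VOperads

variable (V : Type u') [Category.{v'} V] [MonoidalCategory V] [SymmetricCategory V]

/-- A coloured symmetric operad in the symmetric monoidal category `V`. -/
structure VOperad where
  Col : Type u
  Op : {n : ℕ} → (Fin n → Col) → Col → V
  one (x : Col) : 𝟙_ V ⟶ Op (fun _ : Fin 1 => x) x
  comp {n m k : ℕ} {c : Fin n → Col} {x : Col} {b : Fin m → Col} {a : Fin k → Col} {d : Col}
    (g : Graft c x b a) : Op c d ⊗ Op b x ⟶ Op a d
  one_comp {m : ℕ} {x : Col} {b : Fin m → Col} (g : Graft (fun _ : Fin 1 => x) x b b)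
    (hg : ∀ j, g.inner j = j) : one x ▷ Op b x ≫ comp g = (λ_ (Op b x)).hom
  comp_one {n : ℕ} {c : Fin n → Col} {x d : Col} (g : Graft c x (fun _ : Fin 1 => x) c)
    (hg : ∀ j hj, g.outer j hj = j) (hg' : g.inner 0 = g.pos) :
    Op c d ◁ one x ≫ comp g = (ρ_ (Op c d)).hom
  sequential {n m l k r s : ℕ} {c : Fin n → Col} {b : Fin m → Col} {e : Fin l → Col}
    {x y : Col} {a : Fin k → Col} {a' : Fin r → Col} {t : Fin s → Col} {d : Col}
    (g : Graft c x b a) (g' : Graft a y e a') (h : Graft b y e t) (h' : Graft c x t a')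
    (H : g.Sequential g' h h') :
    (comp g : Op c d ⊗ Op b x ⟶ _) ▷ Op e y ≫ comp g' =
      (α_ (Op c d) (Op b x) (Op e y)).hom ≫ Op c d ◁ comp h ≫ comp h'
  parallel {n m l k r s : ℕ} {c : Fin n → Col} {b : Fin m → Col} {e : Fin l → Col}
    {x y : Col} {a : Fin k → Col} {a' : Fin r → Col} {t : Fin s → Col} {d : Col}
    (g : Graft c x b a) (g' : Graft a y e a') (h : Graft c y e t) (h' : Graft t x b a')
    (H : g.Parallel g' h h') :
    (comp g : Op c d ⊗ Op b x ⟶ _) ▷ Op e y ≫ comp g' =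
      (α_ (Op c d) (Op b x) (Op e y)).hom ≫ Op c d ◁ (β_ (Op b x) (Op e y)).hom ≫
        (α_ (Op c d) (Op e y) (Op b x)).inv ≫ comp h ▷ Op b x ≫ comp h'

variable {V}

namespace VOperad

/-- Morphisms of coloured symmetric operads in `V`. -/
@[ext]
structure Hom (O P : VOperad.{u} V) where
  col : O.Col → P.Col
  op {n : ℕ} (c : Fin n → O.Col) (d : O.Col) : O.Op c d ⟶ P.Op (fun i => col (c i)) (col d)
  map_one (x : O.Col) : O.one x ≫ op _ _ = P.one (col x)
  map_comp {n m k : ℕ} {c : Fin n → O.Col} {x : O.Col} {b : Fin m → O.Col} {a : Fin k → O.Col}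
    {d : O.Col} (g : Graft c x b a) :
    O.comp g ≫ op a d = (op c d ⊗ₘ op b x) ≫ P.comp (g.map col)

/-- The category of coloured symmetric operads in `V` (the colours may vary). -/
instance : Category (VOperad.{u} V) where
  Hom := Hom
  id O :=
    { col := fun x => x
      op := fun _ _ => 𝟙 _
      map_one := fun _ => Category.comp_id _
      map_comp := fun g => by
        rw [Category.comp_id, id_tensorHom_id, Category.id_comp]; rfl }
  comp {O P Q} F G :=
    { col := fun x => G.col (F.col x)
      op := fun c d => F.op c d ≫ G.op _ _
      map_one := fun x => by
        rw [← Category.assoc, F.map_one, G.map_one]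
      map_comp := fun g => by
        rw [← Category.assoc, F.map_comp, Category.assoc, G.map_comp, ← Category.assoc,
          tensorHom_comp_tensorHom]
        rfl }
  id_comp F := by
    apply Hom.ext
    · rfl
    · apply heq_of_eq
      funext n c d
      exact Category.id_comp _
  comp_id F := by
    apply Hom.ext
    · rfl
    · apply heq_of_eq
      funext n c d
      exact Category.comp_id _
  assoc F G H := by
    apply Hom.ext
    · rfl
    · apply heq_of_eq
      funext n c d
      exact Category.assoc _ _ _

/-- A unary operation of `O` from `x` to `y`. -/
abbrev Unary (O : VOperad.{u} V) (x y : O.Col) : Type v' :=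
  𝟙_ V ⟶ O.Op (fun _ : Fin 1 => x) y

/-- The composite `q ∘ p` of unary operations. -/
def compUnary (O : VOperad.{u} V) {x y z : O.Col} (q : O.Unary y z) (p : O.Unary x y) :
    O.Unary x z :=
  (λ_ (𝟙_ V)).inv ≫ (q ⊗ₘ p) ≫ O.comp (Graft.unary x y)

/-- A unary operation is invertible if it has a two-sided inverse. -/
def IsInvertible (O : VOperad.{u} V) {x y : O.Col} (p : O.Unary x y) : Prop :=
  ∃ q : O.Unary y x, O.compUnary q p = O.one x ∧ O.compUnary p q = O.one y

/-- The image of a unary operation under a morphism of operads. -/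
def Hom.unary {O P : VOperad.{u} V} (F : O ⟶ P) {x y : O.Col} (p : O.Unary x y) :
    P.Unary (Hom.col F x) (Hom.col F y) :=
  p ≫ Hom.op F (fun _ : Fin 1 => x) y

/-- `F` sends every unary operation of `W` to an invertible one. -/
def Inverts {O P : VOperad.{u} V} (W : ∀ x y : O.Col, Set (O.Unary x y)) (F : O ⟶ P) : Prop :=
  ∀ (x y : O.Col), ∀ p ∈ W x y, P.IsInvertible (Hom.unary F p)

/-- `L : O ⟶ O'` is the (strict) localization of the operad `O` at the set `W` of
unary operations: it is universal among the morphisms of operads which invert `W`. -/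
def IsLocalization {O O' : VOperad.{u} V} (W : ∀ x y : O.Col, Set (O.Unary x y))
    (L : O ⟶ O') : Prop :=
  Inverts W L ∧
    ∀ (P : VOperad.{u} V) (F : O ⟶ P), Inverts W F → ∃! G : O' ⟶ P, L ≫ G = F

end VOperad

/-! ### Operads in sets as operads in `V` -/

section BaseChange

variable [MonoidalClosed V] [HasCoproducts.{w} V]

variable (V) in
/-- The coproduct `∐_X 𝟙` of copies of the monoidal unit. -/
noncomputable def copower (X : Type w) : V := ∐ fun _ : X => 𝟙_ V

/-- The point of `∐_X 𝟙` given by `x : X`. -/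
noncomputable def point {X : Type w} (x : X) : 𝟙_ V ⟶ copower V X :=
  Sigma.ι (fun _ : X => 𝟙_ V) x

/-- The morphism `∐_X 𝟙 ⟶ T` given by a family of points of `T`. -/
noncomputable def copowerDesc {X : Type w} {T : V} (t : X → (𝟙_ V ⟶ T)) : copower V X ⟶ T :=
  Sigma.desc t

/-- The morphism `(∐_X 𝟙) ⊗ (∐_Y 𝟙) ⟶ ∐_Z 𝟙` induced by a map `X × Y → Z`. -/
noncomputable def copowerMap₂ {X Y Z : Type w} (f : X → Y → Z) :
    copower V X ⊗ copower V Y ⟶ copower V Z :=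
  MonoidalClosed.uncurry (copowerDesc fun y =>
    MonoidalClosed.curry ((ρ_ (copower V X)).hom ≫ copowerDesc fun x => point (f x y)))

lemma point_copowerDesc {X : Type w} {T : V} (t : X → (𝟙_ V ⟶ T)) (x : X) :
    point x ≫ copowerDesc t = t x :=
  Sigma.ι_desc _ _

lemma copower_hom_ext {X : Type w} {T : V} {h h' : copower V X ⟶ T}
    (H : ∀ x, point x ≫ h = point x ≫ h') : h = h' :=
  Sigma.hom_ext _ _ H

lemma point_copowerMap₂ {X Y Z : Type w} (f : X → Y → Z) (x : X) (y : Y) :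
    (point (V := V) x ⊗ₘ point y) ≫ copowerMap₂ f = (λ_ (𝟙_ V)).hom ≫ point (f x y) := by
  have h1 : copower V X ◁ point y ≫ copowerMap₂ f =
      (ρ_ (copower V X)).hom ≫ copowerDesc fun x => point (f x y) := by
    apply MonoidalClosed.curry_injective
    rw [MonoidalClosed.curry_natural_left, copowerMap₂, MonoidalClosed.curry_uncurry,
      point_copowerDesc]
  rw [MonoidalCategory.tensorHom_def, Category.assoc, h1, rightUnitor_naturality_assoc,
    ← unitors_equal, point_copowerDesc]

lemma tensor_copower_hom_ext {A : V} {Y : Type w} {T : V} {h h' : A ⊗ copower V Y ⟶ T}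
    (H : ∀ y : Y, A ◁ point y ≫ h = A ◁ point y ≫ h') : h = h' := by
  apply MonoidalClosed.curry_injective
  apply copower_hom_ext
  intro y
  rw [← MonoidalClosed.curry_natural_left, ← MonoidalClosed.curry_natural_left, H]

lemma copower_hom_ext₂ {X Y : Type w} {T : V} {h h' : copower V X ⊗ copower V Y ⟶ T}
    (H : ∀ x y, (point x ⊗ₘ point y) ≫ h = (point x ⊗ₘ point y) ≫ h') : h = h' := by
  apply tensor_copower_hom_ext
  intro y
  rw [← cancel_epi (ρ_ _).inv]
  apply copower_hom_ext
  intro x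
  have := H x y
  rw [MonoidalCategory.tensorHom_def, Category.assoc, Category.assoc] at this
  rw [rightUnitor_inv_naturality_assoc, rightUnitor_inv_naturality_assoc, this]

lemma copower_hom_ext₃ {X Y Z : Type w} {T : V}
    {h h' : (copower V X ⊗ copower V Y) ⊗ copower V Z ⟶ T}
    (H : ∀ x y z, ((point x ⊗ₘ point y) ⊗ₘ point z) ≫ h =
      ((point x ⊗ₘ point y) ⊗ₘ point z) ≫ h') : h = h' := by
  apply tensor_copower_hom_ext
  intro z
  rw [← cancel_epi (ρ_ _).inv]
  apply copower_hom_ext₂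
  intro x y
  have := H x y z
  rw [MonoidalCategory.tensorHom_def, Category.assoc, Category.assoc] at this
  rw [rightUnitor_inv_naturality_assoc, rightUnitor_inv_naturality_assoc, this]

lemma point_copowerMap₂_right {X Y Z U T : Type w} (f : X → Y → U) (k : U → Z → T)
    (x : X) (y : Y) (z : Z) :
    ((point (V := V) x ⊗ₘ point y) ⊗ₘ point z) ≫ copowerMap₂ f ▷ copower V Z ≫ copowerMap₂ k =
      (λ_ (𝟙_ V)).hom ▷ 𝟙_ V ≫ (λ_ (𝟙_ V)).hom ≫ point (k (f x y) z) := by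
  rw [← tensorHom_id, tensorHom_comp_tensorHom_assoc, point_copowerMap₂, Category.comp_id,
    ← Category.id_comp (point z), ← tensorHom_comp_tensorHom_assoc, point_copowerMap₂,
    tensorHom_id]

lemma point_copowerMap₂_left {X Y Z U T : Type w} (f : Y → Z → U) (k : X → U → T)
    (x : X) (y : Y) (z : Z) :
    (point (V := V) x ⊗ₘ (point y ⊗ₘ point z)) ≫ copower V X ◁ copowerMap₂ f ≫ copowerMap₂ k =
      𝟙_ V ◁ (λ_ (𝟙_ V)).hom ≫ (λ_ (𝟙_ V)).hom ≫ point (k x (f y z)) := by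
  rw [← id_tensorHom, tensorHom_comp_tensorHom_assoc, point_copowerMap₂, Category.comp_id,
    ← id_tensorHom, ← Category.id_comp (point x), ← tensorHom_comp_tensorHom_assoc,
    point_copowerMap₂]

variable (V) in
/-- The operad in `V` of an operad `O` in sets, with operations `∐_{O(c;d)} 𝟙`. -/
noncomputable def VOperad.ofSet (O : SetOperad.{w, u}) : VOperad.{u} V where
  Col := O.Col
  Op c d := copower V (O.Op c d)
  one x := point (O.one x)
  comp g := copowerMap₂ (O.comp g)
  one_comp g hg := by
    rw [← cancel_epi (λ_ _).inv]
    apply copower_hom_ext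
    intro p
    rw [leftUnitor_inv_naturality_assoc, ← tensorHom_def'_assoc, point_copowerMap₂,
      Iso.inv_hom_id_assoc, O.one_comp g hg, Iso.inv_hom_id, Category.comp_id]
  comp_one g hg hg' := by
    rw [← cancel_epi (ρ_ _).inv]
    apply copower_hom_ext
    intro p
    rw [rightUnitor_inv_naturality_assoc, ← tensorHom_def_assoc, point_copowerMap₂,
      unitors_equal, Iso.inv_hom_id_assoc, O.comp_one g hg hg', Iso.inv_hom_id, Category.comp_id]
  sequential g g' h h' H := by
    apply copower_hom_ext₃
    intro o p q
    rw [point_copowerMap₂_right, associator_naturality_assoc, point_copowerMap₂_left,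
      O.sequential g g' h h' H]
    monoidal
  parallel g g' h h' H := by
    apply copower_hom_ext₃
    intro o p q
    rw [point_copowerMap₂_right, O.parallel g g' h h' H, associator_naturality_assoc,
      ← id_tensorHom, tensorHom_comp_tensorHom_assoc, BraidedCategory.braiding_naturality,
      Category.comp_id, ← Category.id_comp (point o), ← tensorHom_comp_tensorHom_assoc,
      associator_inv_naturality_assoc, point_copowerMap₂_right,
      braiding_tensorUnit_left]
    monoidal

/-- The functoriality of `VOperad.ofSet`. -/
noncomputable def VOperad.ofSetMap {O P : SetOperad.{w, u}} (F : O.Hom P) :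
    VOperad.ofSet V O ⟶ VOperad.ofSet V P where
  col := F.col
  op _ _ := copowerDesc fun o => point (F.op o)
  map_one x := by
    refine (point_copowerDesc _ _).trans ?_
    exact congrArg point (F.map_one x)
  map_comp g := by
    apply copower_hom_ext₂
    intro o p
    change _ ≫ copowerMap₂ _ ≫ copowerDesc _ =
      _ ≫ (copowerDesc _ ⊗ₘ copowerDesc _) ≫ copowerMap₂ _
    rw [← Category.assoc, point_copowerMap₂, Category.assoc, point_copowerDesc,
      tensorHom_comp_tensorHom_assoc, point_copowerDesc, point_copowerDesc]
    exact (congrArg (fun t => _ ≫ point t) (F.map_comp g o p)).trans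
      (point_copowerMap₂ _ _ _).symm

end BaseChange

end VOperads

/-! ### Orthogonal categories -/

/-- An orthogonality relation on a category: a set of pairs of morphisms with common target which is
symmetric and stable under post- and precomposition. -/
structure Orthogonality (C : Type u) [Category.{v} C] where
  rel : ∀ {X Y Z : C}, (X ⟶ Z) → (Y ⟶ Z) → Prop
  symm : ∀ {X Y Z : C} {f : X ⟶ Z} {g : Y ⟶ Z}, rel f g → rel g f
  post : ∀ {X Y Z Z' : C} {f : X ⟶ Z} {g : Y ⟶ Z} (h : Z ⟶ Z'), rel f g → rel (f ≫ h) (g ≫ h)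
  pre : ∀ {X X' Y Y' Z : C} {f : X ⟶ Z} {g : Y ⟶ Z} (h : X' ⟶ X) (k : Y' ⟶ Y),
    rel f g → rel (h ≫ f) (k ≫ g)

namespace Orthogonality

variable {C : Type u} [Category.{v} C] {D : Type u'} [Category.{v'} D]

/-- The relation underlying the pushforward orthogonality relation. -/
inductive PushforwardRel (orth : Orthogonality C) (F : C ⥤ D) :
    ∀ {X Y Z : D}, (X ⟶ Z) → (Y ⟶ Z) → Prop
  | map {X Y Z : C} (f : X ⟶ Z) (g : Y ⟶ Z) (h : orth.rel f g) :
      PushforwardRel orth F (F.map f) (F.map g)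
  | symm {X Y Z : D} (f : X ⟶ Z) (g : Y ⟶ Z) (h : PushforwardRel orth F f g) :
      PushforwardRel orth F g f
  | post {X Y Z Z' : D} (f : X ⟶ Z) (g : Y ⟶ Z) (k : Z ⟶ Z') (h : PushforwardRel orth F f g) :
      PushforwardRel orth F (f ≫ k) (g ≫ k)
  | pre {X X' Y Y' Z : D} (f : X ⟶ Z) (g : Y ⟶ Z) (k : X' ⟶ X) (l : Y' ⟶ Y)
      (h : PushforwardRel orth F f g) : PushforwardRel orth F (k ≫ f) (l ≫ g)

/-- The pushforward of an orthogonality relation along a functor `F`: the smallest orthogonality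
relation which contains the images under `F` of the orthogonal pairs. -/
def pushforward (orth : Orthogonality C) (F : C ⥤ D) : Orthogonality D where
  rel := PushforwardRel orth F
  symm := PushforwardRel.symm _ _
  post := fun h => PushforwardRel.post _ _ h
  pre := fun h k => PushforwardRel.pre _ _ h k

/-- The orthogonality relation on the localization of `C` at `S`. -/
noncomputable def localization (orth : Orthogonality C) (S : MorphismProperty C) :
    Orthogonality S.Localization :=
  orth.pushforward S.Q

end Orthogonality

/-! ### The operad of algebraic quantum field theories -/

section AQFTOperad

variable {C : Type u} [Category.{v} C]

/-- The operations of the free operad on the following generators, where `C` is the set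
of colours: a unary operation `act f : X → Y` for each morphism `f : X ⟶ Y`, a binary
operation `mul d` and a nullary operation `unit _ d` for each object `d`
(there is only one `c : Fin 0 → C`). -/
inductive Term : {n : ℕ} → (Fin n → C) → C → Type (max u v)
  | act {x y : C} (f : x ⟶ y) : Term (fun _ : Fin 1 => x) y
  | mul (d : C) : Term (fun _ : Fin 2 => d) d
  | unit (c : Fin 0 → C) (d : C) : Term c d
  | one (d : C) : Term (fun _ : Fin 1 => d) d
  | comp {n m k : ℕ} {c : Fin n → C} {x : C} {b : Fin m → C} {a : Fin k → C} {d : C}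
      (g : Graft c x b a) (o : Term c d) (p : Term b x) : Term a d

/-- The relations of the operad of algebraic quantum field theories: the axioms of operads; the
relations of the Boardman-Vogt tensor product of `C` with the operad of unital associative
algebras (functoriality in `C`, the axioms of monoids, and the interchange relations saying that
the operations `act f` are morphisms of monoids); and, for each orthogonal pair `(f, g)`, the
relation `μ ∘ (f, g) = μᵒᵖ ∘ (f, g)`. -/
inductive Rel (orth : Orthogonality C) :
    ∀ {n : ℕ} {c : Fin n → C} {d : C}, Term c d → Term c d → Prop
  -- congruence
  | refl {n : ℕ} {c : Fin n → C} {d : C} (o : Term c d) : Rel orth o o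
  | symm {n : ℕ} {c : Fin n → C} {d : C} {o p : Term c d} : Rel orth o p → Rel orth p o
  | trans {n : ℕ} {c : Fin n → C} {d : C} {o p q : Term c d} :
      Rel orth o p → Rel orth p q → Rel orth o q
  | comp {n m k : ℕ} {c : Fin n → C} {x : C} {b : Fin m → C} {a : Fin k → C} {d : C}
      (g : Graft c x b a) {o o' : Term c d} {p p' : Term b x} :
      Rel orth o o' → Rel orth p p' → Rel orth (Term.comp g o p) (Term.comp g o' p')
  -- axioms of operads
  | one_comp {m : ℕ} {x : C} {b : Fin m → C} (g : Graft (fun _ : Fin 1 => x) x b b)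
      (hg : ∀ j, g.inner j = j) (p : Term b x) : Rel orth (Term.comp g (Term.one x) p) p
  | comp_one {n : ℕ} {c : Fin n → C} {x d : C} (g : Graft c x (fun _ : Fin 1 => x) c)
      (hg : ∀ j hj, g.outer j hj = j) (hg' : g.inner 0 = g.pos) (o : Term c d) :
      Rel orth (Term.comp g o (Term.one x)) o
  | sequential {n m l k r s : ℕ} {c : Fin n → C} {b : Fin m → C} {e : Fin l → C}
      {x y : C} {a : Fin k → C} {a' : Fin r → C} {t : Fin s → C} {d : C}
      (g : Graft c x b a) (g' : Graft a y e a') (h : Graft b y e t) (h' : Graft c x t a')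
      (H : g.Sequential g' h h') (o : Term c d) (p : Term b x) (q : Term e y) :
      Rel orth (Term.comp g' (Term.comp g o p) q) (Term.comp h' o (Term.comp h p q))
  | parallel {n m l k r s : ℕ} {c : Fin n → C} {b : Fin m → C} {e : Fin l → C}
      {x y : C} {a : Fin k → C} {a' : Fin r → C} {t : Fin s → C} {d : C}
      (g : Graft c x b a) (g' : Graft a y e a') (h : Graft c y e t) (h' : Graft t x b a')
      (H : g.Parallel g' h h') (o : Term c d) (p : Term b x) (q : Term e y) :
      Rel orth (Term.comp g' (Term.comp g o p) q) (Term.comp h' (Term.comp h o q) p)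
  -- functoriality
  | act_id (x : C) : Rel orth (Term.act (𝟙 x)) (Term.one x)
  | act_comp {x y z : C} (f : x ⟶ y) (f' : y ⟶ z) :
      Rel orth (Term.comp (Graft.unary x y) (Term.act f') (Term.act f)) (Term.act (f ≫ f'))
  -- monoid axioms; in `mul_unit` the unit may be plugged into either input
  | mul_unit (d : C) (c : Fin 0 → C)
      (g : Graft (fun _ : Fin 2 => d) d c (fun _ : Fin 1 => d)) :
      Rel orth (Term.comp g (Term.mul d) (Term.unit c d)) (Term.one d)
  | mul_assoc (d : C)
      (g h : Graft (fun _ : Fin 2 => d) d (fun _ : Fin 2 => d) (fun _ : Fin 3 => d))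
      (hg : g.pos = 0 ∧ g.inner 0 = 0 ∧ g.inner 1 = 1 ∧ ∃ hj, g.outer 1 hj = 2)
      (hh : h.pos = 1 ∧ h.inner 0 = 1 ∧ h.inner 1 = 2 ∧ ∃ hj, h.outer 0 hj = 0) :
      Rel orth (Term.comp g (Term.mul d) (Term.mul d)) (Term.comp h (Term.mul d) (Term.mul d))
  -- interchange
  | act_unit {x y : C} (f : x ⟶ y) (c : Fin 0 → C) (g : Graft (fun _ : Fin 1 => x) x c c) :
      Rel orth (Term.comp g (Term.act f) (Term.unit c x)) (Term.unit c y)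
  | act_mul {x y : C} (f : x ⟶ y) {r : Fin 2 → C}
      (g : Graft (fun _ : Fin 1 => x) x (fun _ : Fin 2 => x) (fun _ : Fin 2 => x))
      (hg : ∀ j, g.inner j = j)
      (h : Graft (fun _ : Fin 2 => y) y (fun _ : Fin 1 => x) r)
      (h' : Graft r y (fun _ : Fin 1 => x) (fun _ : Fin 2 => x))
      (hh : h.PlugBoth h' 0 1) :
      Rel orth (Term.comp g (Term.act f) (Term.mul x))
        (Term.comp h' (Term.comp h (Term.mul y) (Term.act f)) (Term.act f))
  -- orthogonality
  | comm {x y d : C} (f : x ⟶ d) (f' : y ⟶ d) (hf : orth.rel f f') {r r' a : Fin 2 → C}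
      (g : Graft (fun _ : Fin 2 => d) d (fun _ : Fin 1 => x) r)
      (g' : Graft r d (fun _ : Fin 1 => y) a) (hg : g.PlugBoth g' 0 1)
      (h : Graft (fun _ : Fin 2 => d) d (fun _ : Fin 1 => x) r')
      (h' : Graft r' d (fun _ : Fin 1 => y) a) (hh : h.PlugBoth h' 1 0) :
      Rel orth (Term.comp g' (Term.comp g (Term.mul d) (Term.act f)) (Term.act f'))
        (Term.comp h' (Term.comp h (Term.mul d) (Term.act f)) (Term.act f'))

/-- The AQFT operad of an orthogonal category, as an operad in sets, by generators and
relations. -/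
def setOperad (orth : Orthogonality C) : SetOperad.{max u v, u} where
  Col := C
  Op c d := Quot (Rel orth (c := c) (d := d))
  one x := Quot.mk _ (Term.one x)
  comp g := Quot.map₂ (Term.comp g) (fun o _ _ h => Rel.comp g (Rel.refl o) h)
    (fun _ _ p h => Rel.comp g h (Rel.refl p))
  one_comp g hg p := by
    induction p using Quot.ind
    exact Quot.sound (Rel.one_comp g hg _)
  comp_one g hg hg' o := by
    induction o using Quot.ind
    exact Quot.sound (Rel.comp_one g hg hg' _)
  sequential g g' h h' H o p q := by
    induction o using Quot.ind
    induction p using Quot.ind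
    induction q using Quot.ind
    exact Quot.sound (Rel.sequential g g' h h' H _ _ _)
  parallel g g' h h' H o p q := by
    induction o using Quot.ind
    induction p using Quot.ind
    induction q using Quot.ind
    exact Quot.sound (Rel.parallel g g' h h' H _ _ _)

variable {D : Type u} [Category.{v'} D]

/-- The action of a functor on terms. -/
def Term.map (F : C ⥤ D) : ∀ {n : ℕ} {c : Fin n → C} {d : C},
    Term c d → Term (fun i => F.obj (c i)) (F.obj d)
  | _, _, _, .act f => .act (F.map f)
  | _, _, _, .mul d => .mul (F.obj d)
  | _, _, _, .unit _ d => .unit _ (F.obj d)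
  | _, _, _, .one d => .one (F.obj d)
  | _, _, _, .comp g o p => .comp (g.map F.obj) (o.map F) (p.map F)

lemma Rel.map {orth : Orthogonality C} {orth' : Orthogonality D} (F : C ⥤ D)
    (hF : ∀ {x y d : C} (f : x ⟶ d) (f' : y ⟶ d), orth.rel f f' →
      orth'.rel (F.map f) (F.map f'))
    {n : ℕ} {c : Fin n → C} {d : C} {o p : Term c d} (h : Rel orth o p) :
    Rel orth' (o.map F) (p.map F) := by
  induction h with
  | refl o => exact .refl _
  | symm _ ih => exact .symm ih
  | trans _ _ ih ih' => exact .trans ih ih'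
  | comp g _ _ ih ih' => exact .comp _ ih ih'
  | one_comp g hg p => exact .one_comp (g.map F.obj) hg _
  | comp_one g hg hg' o => exact .comp_one (g.map F.obj) hg hg' _
  | sequential g g' h h' H o p q =>
    exact .sequential (g.map F.obj) (g'.map F.obj) (h.map F.obj) (h'.map F.obj) H _ _ _
  | parallel g g' h h' H o p q =>
    exact .parallel (g.map F.obj) (g'.map F.obj) (h.map F.obj) (h'.map F.obj) H _ _ _
  | act_id x => simpa only [Term.map, F.map_id] using Rel.act_id (orth := orth') (F.obj x)
  | act_comp f f' =>
    have := Rel.act_comp (orth := orth') (F.map f) (F.map f')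
    rw [← F.map_comp] at this
    exact this
  | mul_unit d c g => exact .mul_unit _ _ (g.map F.obj)
  | mul_assoc d g h hg hh => exact .mul_assoc _ (g.map F.obj) (h.map F.obj) hg hh
  | act_unit f c g => exact .act_unit (F.map f) _ (g.map F.obj)
  | act_mul f g hg h h' hh =>
    exact .act_mul (F.map f) (g.map F.obj) hg (h.map F.obj) (h'.map F.obj) hh
  | comm f f' hf g g' hg h h' hh =>
    exact .comm (F.map f) (F.map f') (hF f f' hf) (g.map F.obj) (g'.map F.obj) hg
      (h.map F.obj) (h'.map F.obj) hh

/-- The morphism of operads induced by the localization functor. -/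
noncomputable def setOperadToLocalization (orth : Orthogonality C) (S : MorphismProperty C) :
    (setOperad orth : SetOperad.{max u v, u}).Hom (setOperad (orth.localization S)) where
  col := S.Q.obj
  op := Quot.map (Term.map S.Q) fun _ _ =>
    Rel.map (orth' := orth.localization S) S.Q fun f f' h => .map f f' h
  map_one _ := rfl
  map_comp g o p := by
    induction o using Quot.ind
    induction p using Quot.ind
    rfl

variable (V : Type u') [Category.{v'} V] [MonoidalCategory V] [SymmetricCategory V]
  [MonoidalClosed V] [HasCoproducts.{max u v} V]

/-- The AQFT operad of an orthogonal category, as an operad in `V`. -/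
noncomputable def aqftOperad (orth : Orthogonality C) : VOperad.{u} V :=
  VOperad.ofSet V (setOperad orth)

/-- The AQFT operad of the localized orthogonal category, as an operad in `V`. -/
noncomputable def aqftOperadLocalization (orth : Orthogonality C) (S : MorphismProperty C) :
    VOperad.{u} V :=
  VOperad.ofSet V (setOperad (orth.localization S))

/-- The canonical morphism from the AQFT operad of an orthogonal category to the one of
its localization. -/
noncomputable def toAqftOperadLocalization (orth : Orthogonality C) (S : MorphismProperty C) :
    aqftOperad V orth ⟶ aqftOperadLocalization V orth S :=
  VOperad.ofSetMap (setOperadToLocalization orth S)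

/-- The set of unary operations of the AQFT operad given by the morphisms in `S`. -/
def unaryOfMorphisms (orth : Orthogonality C) (S : MorphismProperty C)
    (x y : C) : Set ((aqftOperad V orth).Unary x y) :=
  {p | ∃ f : x ⟶ y, S f ∧ p = point (Quot.mk _ (Term.act f))}

end AQFTOperad

end AQFT

-- Localizing `C` at `S` does not change the objects, so the generators `mul` and `unit` of the two
-- AQFT operads are the same; only the unary generators change, and those are governed by the
-- universal property of the localized category. The proof makes this precise in two moves.
--
-- Reduction to sets: the points `𝟙_ V ⟶ P.Op c d` of an operad `P` in `V` form an operad in sets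
-- `P.points`, and `ofSet` is left adjoint to this construction. Thus a morphism `ofSet V O ⟶ P` is
-- the same as a morphism from `O` to `P.points` (`toMap`, `ofMap`). Unary operations of `P` are
-- exactly unary operations of `P.points`, with the same composition, so inverting `S` means the
-- same on both sides.
--
-- Extension in sets: let `F` be a morphism from the AQFT operad of `C` to an operad in sets `P`.
-- Its values on the operations `act f` form a functor from `C` to the category of unary operations
-- of `P`. If `F` inverts `S`, this functor factors uniquely through `S.Localization`. Together with
-- the old values on `mul` and `unit`, the factorization gives values on all generators of the
-- localized operad, and it remains to check the relations. The monoid axioms do not involve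
-- morphisms of `C`. The interchange relations hold on the image of `C` and are stable under
-- composition and inverses of unary operations, hence hold for every localized morphism
-- (`liftAct_unit`, `liftAct_mul`). The commutation relation holds for images of orthogonal pairs
-- and is stable under symmetry and precomposition; it is stable under postcomposition because of
-- the interchange relation. Hence it holds on the whole pushforward relation (`liftAct_commute`).
-- Uniqueness holds because every generator is determined (`ext_of_compMap`).

universe w'

namespace AQFT

/-! ### Grafts that renumber inputs or plug in unary operations -/

namespace Graft

variable {K : Type u}

lemma ext' {n m k : ℕ} {c : Fin n → K} {x : K} {b : Fin m → K} {a : Fin k → K}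
    {g h : Graft c x b a} (hp : g.pos = h.pos)
    (ho : ∀ j hj hj', g.outer j hj = h.outer j hj') (hi : ∀ j, g.inner j = h.inner j) :
    g = h := by
  obtain ⟨p, hp₁, e, ho₁, hi₁⟩ := g
  obtain ⟨q, hq₁, e', ho₂, hi₂⟩ := h
  obtain rfl : p = q := hp
  obtain rfl : e = e' := by
    ext (j | j) : 1
    · exact ho j.1 j.2 j.2
    · exact hi j
  rfl

/-- Plugging an operation into a unary one, with a permutation of its inputs. -/
def post {m k : ℕ} {b : Fin m → K} {a : Fin k → K} (x : K) (σ : Fin m ≃ Fin k)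
    (h : ∀ j, a (σ j) = b j) : Graft (fun _ : Fin 1 => x) x b a where
  pos := 0
  pos_col := rfl
  num :=
    haveI : IsEmpty {j : Fin 1 // j ≠ 0} := ⟨fun j => j.2 (Subsingleton.elim _ _)⟩
    (Equiv.emptySum _ _).trans σ
  outer_col j := absurd (Subsingleton.elim _ _) j.2
  inner_col j := h j

/-- Plugging a unary operation into the input `i`, without renumbering the inputs. -/
def plug {n : ℕ} {c a : Fin n → K} {x y : K} (i : Fin n) (hx : c i = x) (hy : a i = y)
    (h : ∀ j, j ≠ i → a j = c j) : Graft c x (fun _ : Fin 1 => y) a where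
  pos := i
  pos_col := hx
  num :=
    { toFun := Sum.elim (fun j => j.1) (fun _ => i)
      invFun := fun j => if hj : j = i then Sum.inr 0 else Sum.inl ⟨j, hj⟩
      left_inv := by
        rintro (⟨j, hj⟩ | j)
        · simp [hj]
        · simp [Subsingleton.elim j 0]
      right_inv := by
        intro j
        by_cases hj : j = i <;> simp [hj] }
  outer_col j := h j.1 j.2
  inner_col _ := hy

/-- Renumbering the inputs of a composite. -/
def renumber {n m k l : ℕ} {c : Fin n → K} {x : K} {b : Fin m → K} {a : Fin k → K}
    {a' : Fin l → K} (g : Graft c x b a) (σ : Fin k ≃ Fin l) (h : ∀ j, a' (σ j) = a j) :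
    Graft c x b a' where
  pos := g.pos
  pos_col := g.pos_col
  num := g.num.trans σ
  outer_col j := (h _).trans (g.outer_col j)
  inner_col j := (h _).trans (g.inner_col j)

section

variable {n m k l : ℕ} {c : Fin n → K} {x y : K} {b : Fin m → K} {a : Fin n → K}

@[simp] lemma plug_pos (i : Fin n) (hx : c i = x) (hy : a i = y)
    (h : ∀ j, j ≠ i → a j = c j) : (plug i hx hy h).pos = i := rfl

@[simp] lemma plug_inner (i : Fin n) (hx : c i = x) (hy : a i = y)
    (h : ∀ j, j ≠ i → a j = c j) (j : Fin 1) : (plug i hx hy h).inner j = i := rfl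

variable {a : Fin k → K} {a' : Fin l → K}

@[simp] lemma renumber_pos (g : Graft c x b a) (σ : Fin k ≃ Fin l) (h : ∀ j, a' (σ j) = a j) :
    (g.renumber σ h).pos = g.pos := rfl

end

/-- The relations quantify over arbitrary colour lists `a`; this lemma and the next show that
`PlugBoth` leaves no freedom in `a`. -/
lemma PlugBoth.col_zero {d x y : K} {r a : Fin 2 → K} {h h'} {i j : Fin 2}
    (H : PlugBoth (d := d) (x := x) (y := y) (r := r) (a := a) h h' i j) : a 0 = x := by
  obtain ⟨_, _, ⟨_, h₅⟩, _⟩ := H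
  rw [← h₅]
  exact (h'.outer_col _).trans (h.inner_col 0)

lemma PlugBoth.col_one {d x y : K} {r a : Fin 2 → K} {h h'} {i j : Fin 2}
    (H : PlugBoth (d := d) (x := x) (y := y) (r := r) (a := a) h h' i j) : a 1 = y := by
  rw [← H.2.2.2]
  exact h'.inner_col 0

end Graft

/-! ### Composition with unary operations in an operad in sets -/

namespace SetOperad

variable (P : SetOperad.{w, u})

/-- The composite `u ∘ o` of an operation `o` with a unary operation `u`, with its inputs
renumbered by `σ`. -/
def post {m k : ℕ} {b : Fin m → P.Col} {a : Fin k → P.Col} {x y : P.Col} (σ : Fin m ≃ Fin k)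
    (h : ∀ j, a (σ j) = b j) (p : P.Op (fun _ : Fin 1 => x) y) (o : P.Op b x) : P.Op a y :=
  P.comp (Graft.post x σ h) p o

/-- The composite `o ∘ᵢ p` of an operation `o` with a unary operation `p`. -/
def plug {n : ℕ} {c a : Fin n → P.Col} {x y d : P.Col} (i : Fin n) (hx : c i = x)
    (hy : a i = y) (h : ∀ j, j ≠ i → a j = c j) (o : P.Op c d)
    (p : P.Op (fun _ : Fin 1 => y) x) : P.Op a d :=
  P.comp (Graft.plug i hx hy h) o p

/-- The composite of unary operations. -/
def unaryComp {x y z : P.Col} (q : P.Op (fun _ : Fin 1 => y) z)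
    (p : P.Op (fun _ : Fin 1 => x) y) : P.Op (fun _ : Fin 1 => x) z :=
  P.comp (Graft.unary x y) q p

lemma one_unaryComp {x y : P.Col} (p : P.Op (fun _ : Fin 1 => x) y) :
    P.unaryComp (P.one y) p = p :=
  P.one_comp _ (fun _ => rfl) p

lemma unaryComp_one {x y : P.Col} (p : P.Op (fun _ : Fin 1 => x) y) :
    P.unaryComp p (P.one x) = p :=
  P.comp_one _ (fun _ hj => absurd (Subsingleton.elim _ _) hj) rfl p

lemma unaryComp_assoc {x y z t : P.Col} (r : P.Op (fun _ : Fin 1 => z) t)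
    (q : P.Op (fun _ : Fin 1 => y) z) (p : P.Op (fun _ : Fin 1 => x) y) :
    P.unaryComp (P.unaryComp r q) p = P.unaryComp r (P.unaryComp q p) := by
  refine P.sequential (Graft.unary y z) (Graft.unary x y) (Graft.unary x y) (Graft.unary x z)
    ⟨rfl, rfl, ?_, ?_, fun _ => rfl⟩ r q p
  · exact fun j hj => absurd (Subsingleton.elim _ _) hj
  · exact fun j hj => absurd (Subsingleton.elim _ _) hj

section

variable {n m k : ℕ} {x y z d : P.Col}

lemma post_one {b : Fin m → P.Col} (h : ∀ j, b (Equiv.refl _ j) = b j) (o : P.Op b x) :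
    P.post (Equiv.refl _) h (P.one x) o = o :=
  P.one_comp _ (fun _ => rfl) o

lemma plug_one {c : Fin n → P.Col} (i : Fin n) (hx hx' : c i = x) (h) (o : P.Op c d) :
    P.plug i hx hx' h o (P.one x) = o :=
  P.comp_one _ (fun _ _ => rfl) rfl o

lemma post_post {l : ℕ} {b : Fin m → P.Col} {a : Fin k → P.Col} {a' : Fin l → P.Col}
    (σ : Fin m ≃ Fin k) (h) (τ : Fin k ≃ Fin l) (h')
    (q : P.Op (fun _ : Fin 1 => y) z) (p : P.Op (fun _ : Fin 1 => x) y) (o : P.Op b x) :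
    P.post τ h' q (P.post (a := a) σ h p o) = P.post (a := a') (σ.trans τ)
      (fun j => (h' _).trans (h j)) (P.unaryComp q p) o := by
  symm
  refine P.sequential (Graft.unary x y) (Graft.post x (σ.trans τ) _) (Graft.post x σ h)
    (Graft.post y τ h') ⟨rfl, rfl, ?_, ?_, fun _ => rfl⟩ q p o
  · exact fun j hj => absurd (Subsingleton.elim _ _) hj
  · exact fun j hj => absurd (Subsingleton.elim _ _) hj

/-- Sequential associativity. The renumbering `σ` belongs to the outer graft, so the input `i` of
`o` appears as `σ i` once `q` and `σ` have been applied. -/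
lemma plug_post {c a b a' : Fin n → P.Col} (σ : Fin n ≃ Fin n) (i i' : Fin n) (hi : σ i = i')
    (h : ∀ j, a (σ j) = c j) (h' : ∀ j, a' (σ j) = b j) (hx : c i = x) (hy : b i = y)
    (hb : ∀ j, j ≠ i → b j = c j) (hx' : a i' = x) (hy' : a' i' = y)
    (ha : ∀ j, j ≠ i' → a' j = a j)
    (q : P.Op (fun _ : Fin 1 => z) d) (o : P.Op c z) (p : P.Op (fun _ : Fin 1 => y) x) :
    P.plug i' hx' hy' ha (P.post σ h q o) p = P.post σ h' q (P.plug i hx hy hb o p) := by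
  subst hi
  refine P.sequential (Graft.post z σ h) (Graft.plug (σ i) hx' hy' ha) (Graft.plug i hx hy hb)
    (Graft.post z σ h') ⟨rfl, rfl, ?_, fun _ _ _ => rfl, fun _ => rfl⟩ q o p
  exact fun j hj => absurd (Subsingleton.elim _ _) hj

lemma plug_plug {c a a' : Fin n → P.Col} (i : Fin n) (hx : c i = x) (hy : a i = y) (h)
    (hy' : a i = y) (hz : a' i = z) (h') (o : P.Op c d) (p : P.Op (fun _ : Fin 1 => y) x)
    (q : P.Op (fun _ : Fin 1 => z) y) :
    P.plug i hy' hz h' (P.plug i hx hy h o p) q =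
      P.plug i hx hz (fun j hj => (h' j hj).trans (h j hj)) o (P.unaryComp p q) := by
  refine P.sequential (Graft.plug i hx hy h) (Graft.plug i hy' hz h') (Graft.unary z y)
    (Graft.plug i hx hz _) ⟨rfl, rfl, fun _ _ _ _ => rfl, ?_, fun _ => rfl⟩ o p q
  exact fun j hj => absurd (Subsingleton.elim _ _) hj

lemma plug_plug_comm {c a b a' : Fin n → P.Col} {y' z' : P.Col} (i j : Fin n) (hij : i ≠ j)
    (hx : c i = x) (hy : a i = y) (ha) (hx' : a j = y') (hz : a' j = z') (ha')
    (kx : c j = y') (ky : b j = z') (kb) (kx' : b i = x) (kz : a' i = y) (ka')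
    (o : P.Op c d) (p : P.Op (fun _ : Fin 1 => y) x) (q : P.Op (fun _ : Fin 1 => z') y') :
    P.plug j hx' hz ha' (P.plug (a := a) i hx hy ha o p) q =
      P.plug i kx' kz ka' (P.plug (a := b) j kx ky kb o q) p :=
  P.parallel (Graft.plug i hx hy ha) (Graft.plug j hx' hz ha') (Graft.plug j kx ky kb)
    (Graft.plug i kx' kz ka') ⟨⟨hij.symm, rfl⟩, ⟨hij, rfl⟩, fun _ _ _ _ _ => rfl,
    fun _ _ => rfl, fun _ _ => rfl⟩ o p q

/-- Permutations act by composition with an identity, so sequential associativity with outer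
operation `one d` absorbs the permutation into the numbering of the graft. -/
lemma post_one_comp {l : ℕ} {c : Fin n → P.Col} {b : Fin m → P.Col} {a : Fin k → P.Col}
    {a' : Fin l → P.Col} (g : Graft c x b a) (σ : Fin k ≃ Fin l) (h : ∀ j, a' (σ j) = a j)
    (o : P.Op c d) (p : P.Op b x) :
    P.post σ h (P.one d) (P.comp g o p) = P.comp (g.renumber σ h) o p := by
  have H := P.sequential (Graft.post (b := c) (a := c) d (Equiv.refl _) (fun _ => rfl))
    (g.renumber σ h) g (Graft.post d σ h) ⟨rfl, rfl,
      fun j hj => absurd (Subsingleton.elim _ _) hj,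
      fun _ _ _ => rfl, fun _ => rfl⟩ (P.one d) o p
  exact H.symm.trans (congrArg (fun t => P.comp (g.renumber σ h) t p)
    (P.one_comp _ (fun _ => rfl) o))

end

/-- The composite `p ∘ o` of an operation `o` with a unary operation `p`. -/
def postId {m : ℕ} {b : Fin m → P.Col} {x y : P.Col} (p : P.Op (fun _ : Fin 1 => x) y)
    (o : P.Op b x) : P.Op b y :=
  P.post (Equiv.refl _) (fun j => congrArg b (Equiv.refl_apply j)) p o

section

variable {m : ℕ} {b : Fin m → P.Col} {x y z d : P.Col}

lemma one_postId (o : P.Op b x) : P.postId (P.one x) o = o :=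
  P.post_one _ o

lemma postId_postId (q : P.Op (fun _ : Fin 1 => y) z) (p : P.Op (fun _ : Fin 1 => x) y)
    (o : P.Op b x) : P.postId q (P.postId p o) = P.postId (P.unaryComp q p) o :=
  P.post_post _ _ _ _ q p o

lemma comp_eq_postId (g : Graft (fun _ : Fin 1 => x) x b b) (hg : ∀ j, g.inner j = j)
    (p : P.Op (fun _ : Fin 1 => x) y) (o : P.Op b x) : P.comp g p o = P.postId p o := by
  obtain rfl : g = Graft.post x (Equiv.refl _) (fun j => congrArg b (Equiv.refl_apply j)) :=
    Graft.ext' (Subsingleton.elim _ _) (fun j hj => absurd (Subsingleton.elim _ _) hj) hg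
  rfl

lemma plug_postId {a : Fin m → P.Col} (i : Fin m) (hx : b i = x) (hy : a i = y)
    (h : ∀ j, j ≠ i → a j = b j) (q : P.Op (fun _ : Fin 1 => z) d) (o : P.Op b z)
    (p : P.Op (fun _ : Fin 1 => y) x) :
    P.plug i hx hy h (P.postId q o) p = P.postId q (P.plug i hx hy h o p) :=
  P.plug_post (Equiv.refl _) i i rfl _ _ hx hy h hx hy h q o p

end

/-! ### Binary operations, their opposites, and commuting unary operations -/

section Binary

variable {x y z d : P.Col}

/-- A pair of colours. -/
def pair (x y : P.Col) : Fin 2 → P.Col := ![x, y]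

lemma pair_zero (x y : P.Col) : P.pair x y 0 = x := rfl

lemma pair_one (x y : P.Col) : P.pair x y 1 = y := rfl

lemma forall_ne_zero {c a : Fin 2 → P.Col} (h : a 1 = c 1) : ∀ j, j ≠ 0 → a j = c j := by
  simpa [Fin.forall_fin_two] using h

lemma forall_ne_one {c a : Fin 2 → P.Col} (h : a 0 = c 0) : ∀ j, j ≠ 1 → a j = c j := by
  simpa [Fin.forall_fin_two] using h

/-- The composite `o ∘ (p, q)` of a binary operation with two unary operations. -/
def plugTwo {c a : Fin 2 → P.Col} {x' y' : P.Col} (hx : c 0 = x) (hy : c 1 = y)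
    (hx' : a 0 = x') (hy' : a 1 = y') (o : P.Op c d)
    (p : P.Op (fun _ : Fin 1 => x') x) (q : P.Op (fun _ : Fin 1 => y') y) : P.Op a d :=
  P.plug 1 (P.pair_one x' y) hy' (P.forall_ne_one (hx'.trans (P.pair_zero x' y).symm))
    (P.plug 0 hx (P.pair_zero x' y) (P.forall_ne_zero ((P.pair_one x' y).trans hy.symm)) o p) q

variable {c a a' : Fin 2 → P.Col} {x' y' x'' y'' : P.Col}

lemma plug_one_plug_zero {r : Fin 2 → P.Col} (hx : c 0 = x) (hy : c 1 = y) (hr : r 0 = x')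
    (hr' : r 1 = y) (hx' : a 0 = x') (hy' : a 1 = y') (h h') (o : P.Op c d)
    (p : P.Op (fun _ : Fin 1 => x') x) (q : P.Op (fun _ : Fin 1 => y') y) :
    P.plug 1 hr' hy' h' (P.plug 0 hx hr h o p) q = P.plugTwo hx hy hx' hy' o p q := by
  obtain rfl : r = P.pair x' y := by
    funext i
    fin_cases i <;> assumption
  rfl

lemma plug_zero_plug_one {r : Fin 2 → P.Col} (hx : c 0 = x) (hy : c 1 = y) (hr : r 1 = y')
    (hr' : r 0 = x) (hx' : a 0 = x') (hy' : a 1 = y') (h h') (o : P.Op c d)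
    (p : P.Op (fun _ : Fin 1 => x') x) (q : P.Op (fun _ : Fin 1 => y') y) :
    P.plug 0 hr' hx' h' (P.plug 1 hy hr h o q) p = P.plugTwo hx hy hx' hy' o p q :=
  P.plug_plug_comm 1 0 (by decide) _ _ _ _ _ _ _ _ _ _ _ _ _ _ _

lemma plugTwo_one (hx hx' : c 0 = x) (hy hy' : c 1 = y) (o : P.Op c d) :
    P.plugTwo hx hy hx' hy' o (P.one x) (P.one y) = o := by
  rw [← P.plug_one_plug_zero (r := c) hx hy hx hy hx' hy' (fun _ _ => rfl) (fun _ _ => rfl),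
    plug_one, plug_one]

/-- `Commute` is stated over the list `pair x y`, the relations over any list with these two
entries; this passes between such lists. -/
lemma plugTwo_eq_of_eq (hx : c 0 = x) (hy : c 1 = y) (hx' : a 0 = x') (hy' : a 1 = y')
    (k : a' 0 = x') (k' : a' 1 = y') {o o' : P.Op c d} {p : P.Op (fun _ : Fin 1 => x') x}
    {q : P.Op (fun _ : Fin 1 => y') y}
    (H : P.plugTwo hx hy hx' hy' o p q = P.plugTwo hx hy hx' hy' o' p q) :
    P.plugTwo hx hy k k' o p q = P.plugTwo hx hy k k' o' p q := by
  obtain rfl : a = a' := by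
    funext i
    fin_cases i
    · exact hx'.trans k.symm
    · exact hy'.trans k'.symm
  exact H

lemma plugTwo_plugTwo (hx : c 0 = x) (hy : c 1 = y) (hx' k : a 0 = x') (hy' k' : a 1 = y')
    (hx'' : a' 0 = x'') (hy'' : a' 1 = y'') (o : P.Op c d)
    (p : P.Op (fun _ : Fin 1 => x') x) (q : P.Op (fun _ : Fin 1 => y') y)
    (p' : P.Op (fun _ : Fin 1 => x'') x') (q' : P.Op (fun _ : Fin 1 => y'') y') :
    P.plugTwo k k' hx'' hy'' (P.plugTwo hx hy hx' hy' o p q) p' q' =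
      P.plugTwo hx hy hx'' hy'' o (P.unaryComp p p') (P.unaryComp q q') := by
  have h₀ := P.forall_ne_zero (c := P.pair x y') (hy'.trans (P.pair_one x y').symm)
  have h₁ := P.forall_ne_one (c := c) ((P.pair_zero x y').trans hx.symm)
  -- The order of the inner pair is reversed so that `p` is plugged last and fuses with `p'`;
  -- exchanging once more brings `q` next to `q'`.
  rw [← P.plug_zero_plug_one hx hy (P.pair_one x y') (P.pair_zero x y') hx' hy' h₁ h₀,
    plugTwo, plug_plug, P.plug_zero_plug_one hx hy _ _ (P.pair_zero x'' y') (P.pair_one x'' y'),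
    plugTwo, plug_plug]
  rfl

lemma plugTwo_postId (hx : c 0 = x) (hy : c 1 = y) (hx' : a 0 = x') (hy' : a 1 = y')
    (r : P.Op (fun _ : Fin 1 => d) z) (o : P.Op c d)
    (p : P.Op (fun _ : Fin 1 => x') x) (q : P.Op (fun _ : Fin 1 => y') y) :
    P.plugTwo hx hy hx' hy' (P.postId r o) p q =
      P.postId r (P.plugTwo hx hy hx' hy' o p q) := by
  rw [plugTwo, plug_postId, plug_postId]
  rfl

/-- The operation `o` with its two inputs exchanged. -/
def swap (h : ∀ j, a (Equiv.swap 0 1 j) = c j) (o : P.Op c d) : P.Op a d :=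
  P.post (Equiv.swap 0 1) h (P.one d) o

lemma plugTwo_swap {b : Fin 2 → P.Col} (hx : c 0 = x) (hy : c 1 = y) (k : b 0 = y)
    (k' : b 1 = x) (hx' : a 0 = y') (hy' : a 1 = x') (o : P.Op c d)
    (p : P.Op (fun _ : Fin 1 => x') x) (q : P.Op (fun _ : Fin 1 => y') y)
    (h : ∀ j, b (Equiv.swap 0 1 j) = c j) (h' : ∀ j, a (Equiv.swap 0 1 j) = a' j)
    (l : a' 0 = x') (l' : a' 1 = y') :
    P.plugTwo k k' hx' hy' (P.swap h o) q p =
      P.swap h' (P.plugTwo hx hy l l' o p q) := by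
  have h₀ := P.forall_ne_zero (c := P.pair x y') (l'.trans (P.pair_one x y').symm)
  have h₁ := P.forall_ne_one (c := c) ((P.pair_zero x y').trans hx.symm)
  rw [plugTwo, swap, P.plug_post (b := P.pair x y') _ 1 0 (Equiv.swap_apply_right _ _) _ _ hy
    (P.pair_one x y') h₁, P.plug_post (b := a') _ 0 1 (Equiv.swap_apply_left _ _) _ h'
      (P.pair_zero x y') l h₀, P.plug_zero_plug_one hx hy]
  · rfl
  · simp [Fin.forall_fin_two, pair_zero, pair_one]

lemma swap_postId (h : ∀ j, a (Equiv.swap 0 1 j) = c j) (p : P.Op (fun _ : Fin 1 => x) d)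
    (o : P.Op c x) : P.swap h (P.postId p o) = P.postId p (P.swap h o) := by
  rw [swap, postId, post_post, swap, postId, post_post, one_unaryComp, unaryComp_one]
  rfl

/-- The two pairs of grafts may differ in their intermediate numberings and colours `r`, `r'`. Both
composites agree with a third one, in which `q` is plugged in before `p`, by parallel associativity.
-/
lemma comp_comp_eq_of_plugBoth {r r' : Fin 2 → P.Col} {h h' k k'} {i j : Fin 2} (hij : i ≠ j)
    (H : Graft.PlugBoth (d := d) (x := x) (y := y) (r := r) (a := a) h h' i j)
    (H' : Graft.PlugBoth (d := d) (x := x) (y := y) (r := r') (a := a) k k' i j)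
    (o : P.Op (fun _ : Fin 2 => d) d) (p : P.Op (fun _ : Fin 1 => x) d)
    (q : P.Op (fun _ : Fin 1 => y) d) :
    P.comp h' (P.comp h o p) q = P.comp k' (P.comp k o p) q := by
  have hx := H.col_zero
  have hy := H.col_one
  have aux : ∀ t : Fin 2, t ≠ i ↔ t = j := by omega
  -- The reference composite `l`, `l'` depends only on `i`, `j` and the colours. In `l'` the new
  -- input, that of `p`, gets number `0` and the remaining one, that of `q`, gets number `1`, as
  -- `PlugBoth` requires.
  let t : Fin 2 → P.Col := fun s => if s = j then y else d
  let l : Graft (fun _ : Fin 2 => d) d (fun _ : Fin 1 => y) t :=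
    Graft.plug j rfl (if_pos rfl) (fun s hs => if_neg hs)
  let l' : Graft t d (fun _ : Fin 1 => x) a :=
    { pos := i
      pos_col := if_neg hij
      num :=
        { toFun := Sum.elim (fun _ => 1) (fun _ => 0)
          invFun := fun s => if s = 0 then Sum.inr 0 else Sum.inl ⟨j, hij.symm⟩
          left_inv := by
            rintro (⟨s, hs⟩ | s)
            · simp [(aux s).1 hs]
            · simp [Subsingleton.elim s 0]
          right_inv := fun s => by
            fin_cases s <;> simp }
      outer_col := fun s => by
        rw [(aux s.1).1 s.2]
        exact hy.trans (if_pos rfl).symm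
      inner_col := fun _ => hx }
  have key : ∀ {r : Fin 2 → P.Col} (h : Graft (fun _ : Fin 2 => d) d (fun _ : Fin 1 => x) r)
      (h' : Graft r d (fun _ : Fin 1 => y) a), Graft.PlugBoth h h' i j →
      P.comp h' (P.comp h o p) q = P.comp l' (P.comp l o q) p := by
    rintro r h h' ⟨h₁, ⟨h₂, h₃⟩, ⟨h₄, h₅⟩, h₆⟩
    refine P.parallel h h' l l' ⟨⟨h₂, h₃⟩, ⟨h₁ ▸ hij, h₁.symm⟩, ?_, ?_, ?_⟩ o p q
    · intro s hs _ hs'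
      exact absurd ((aux s).1 (h₁ ▸ hs)) hs'
    · intro s hs
      obtain rfl := Subsingleton.elim 0 s
      exact h₅
    · intro s hs
      obtain rfl := Subsingleton.elim 0 s
      exact h₆
  rw [key h h' H, key k k' H']

lemma comp_comp_eq_plugTwo {r : Fin 2 → P.Col} {h h'}
    (H : Graft.PlugBoth (d := d) (x := x) (y := y) (r := r) (a := a) h h' 0 1)
    (hx : a 0 = x) (hy : a 1 = y)
    (o : P.Op (fun _ : Fin 2 => d) d) (p : P.Op (fun _ : Fin 1 => x) d)
    (q : P.Op (fun _ : Fin 1 => y) d) :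
    P.comp h' (P.comp h o p) q = P.plugTwo rfl rfl hx hy o p q :=
  P.comp_comp_eq_of_plugBoth (by decide) H
    ⟨rfl, ⟨by simp, rfl⟩, ⟨by simp, rfl⟩, rfl⟩ o p q

lemma comp_comp_eq_plugTwo_swap {r : Fin 2 → P.Col} {h h'}
    (H : Graft.PlugBoth (d := d) (x := x) (y := y) (r := r) (a := a) h h' 1 0)
    (hx : a 0 = x) (hy : a 1 = y)
    (o : P.Op (fun _ : Fin 2 => d) d) (p : P.Op (fun _ : Fin 1 => x) d)
    (q : P.Op (fun _ : Fin 1 => y) d) :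
    P.comp h' (P.comp h o p) q =
      P.plugTwo (c := fun _ => d) rfl rfl hx hy (P.swap (fun _ => rfl) o) p q := by
  have h' : ∀ j, a (Equiv.swap 0 1 j) = P.pair y x j := by
    simp [Fin.forall_fin_two, pair_zero, pair_one, hx, hy]
  have h₀ := P.forall_ne_zero (c := P.pair d x)
    ((P.pair_one y x).trans (P.pair_one d x).symm)
  have h₁ := P.forall_ne_one (c := fun _ => d) (P.pair_zero d x)
  -- The opposite of `o` applied to `(p, q)` is the swap of `o` applied to `(q, p)`. Plugging `p`
  -- into input `1` first and absorbing the swap into the last graft gives a `PlugBoth` pair for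
  -- `1`, `0`.
  rw [P.plugTwo_swap (c := fun _ => d) rfl rfl rfl rfl hx hy o q p _ h'
    (P.pair_zero y x) (P.pair_one y x), ← P.plug_zero_plug_one rfl rfl (P.pair_one d x)
    (P.pair_zero d x) _ _ h₁ h₀, swap]
  refine Eq.trans ?_ (P.post_one_comp _ _ _ _ _).symm
  exact P.comp_comp_eq_of_plugBoth (by decide) H
    ⟨rfl, ⟨by simp, rfl⟩, ⟨by simp, rfl⟩, rfl⟩ o p q

variable {z' : P.Col}

/-- The unary operations `p` and `q` commute with respect to the binary operation `m`. -/
def Commute (m : P.Op (fun _ : Fin 2 => z) d) (p : P.Op (fun _ : Fin 1 => x) z)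
    (q : P.Op (fun _ : Fin 1 => y) z) : Prop :=
  P.plugTwo (c := fun _ => z) rfl rfl (P.pair_zero x y) (P.pair_one x y) m p q =
    P.plugTwo (c := fun _ => z) rfl rfl (P.pair_zero x y) (P.pair_one x y)
      (P.swap (fun _ => rfl) m) p q

variable {P}

lemma Commute.pre {m : P.Op (fun _ : Fin 2 => z) d} {p : P.Op (fun _ : Fin 1 => x) z}
    {q : P.Op (fun _ : Fin 1 => y) z} (H : P.Commute m p q)
    (p' : P.Op (fun _ : Fin 1 => x') x) (q' : P.Op (fun _ : Fin 1 => y') y) :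
    P.Commute m (P.unaryComp p p') (P.unaryComp q q') := by
  have H' := congrArg (fun t => P.plugTwo (P.pair_zero x y) (P.pair_one x y)
    (P.pair_zero x' y') (P.pair_one x' y') t p' q') H
  rwa [P.plugTwo_plugTwo, P.plugTwo_plugTwo] at H'

/-- Since `r` is multiplicative, it carries `m ∘ (p, q)` to `m' ∘ (r ∘ p, r ∘ q)`. It is then also
multiplicative for the opposite products (`hr'`), so it carries one side of the hypothesis to each
side of the conclusion. -/
lemma Commute.post {m : P.Op (fun _ : Fin 2 => z) z} {p : P.Op (fun _ : Fin 1 => x) z}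
    {q : P.Op (fun _ : Fin 1 => y) z} (H : P.Commute m p q)
    {m' : P.Op (fun _ : Fin 2 => z') z'} {r : P.Op (fun _ : Fin 1 => z) z'}
    (hr : P.postId r m = P.plugTwo (c := fun _ => z') (a := fun _ => z) rfl rfl rfl rfl m' r r) :
    P.Commute m' (P.unaryComp r p) (P.unaryComp r q) := by
  have hr' : P.postId r (P.swap (a := fun _ => z) (fun _ => rfl) m) =
      P.plugTwo (c := fun _ => z') (a := fun _ => z) rfl rfl rfl rfl
        (P.swap (fun _ => rfl) m') r r := by
    rw [← P.swap_postId, hr, P.plugTwo_swap (c := fun _ => z') (a' := fun _ => z) rfl rfl rfl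
      rfl rfl rfl _ _ _ _ (fun _ => rfl) rfl rfl]
  have H' := congrArg (P.postId r) H
  rwa [← P.plugTwo_postId, ← P.plugTwo_postId, hr', hr,
    P.plugTwo_plugTwo, P.plugTwo_plugTwo] at H'

end Binary

/-! ### Morphisms across universes and the category of unary operations -/

/-- Morphisms of coloured symmetric operads in sets, with operations in different universes. -/
structure Map (O : SetOperad.{w, u}) (P : SetOperad.{w', u'}) where
  col : O.Col → P.Col
  op {n : ℕ} {c : Fin n → O.Col} {d : O.Col} : O.Op c d → P.Op (fun i => col (c i)) (col d)
  map_one (x : O.Col) : op (O.one x) = P.one (col x)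
  map_comp {n m k : ℕ} {c : Fin n → O.Col} {x : O.Col} {b : Fin m → O.Col} {a : Fin k → O.Col}
    {d : O.Col} (g : Graft c x b a) (o : O.Op c d) (p : O.Op b x) :
    op (O.comp g o p) = P.comp (g.map col) (op o) (op p)

lemma Map.ext' {O : SetOperad.{w, u}} {P : SetOperad.{w', u'}} {F G : Map O P}
    (h : F.col = G.col) (h' : ∀ {n : ℕ} {c : Fin n → O.Col} {d : O.Col} (o : O.Op c d),
      F.op o ≍ G.op o) : F = G := by
  obtain ⟨φ, op, _, _⟩ := F
  obtain ⟨φ', op', _, _⟩ := G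
  obtain rfl : φ = φ' := h
  obtain rfl : @op = @op' := by
    funext n c d o
    exact eq_of_heq (h' o)
  rfl

/-- The composite of two morphisms of operads. -/
def Hom.compMap {O O' : SetOperad.{w, u}} {P : SetOperad.{w', u'}} (F : O.Hom O')
    (G : Map O' P) : Map O P where
  col x := G.col (F.col x)
  op o := G.op (F.op o)
  map_one x := by rw [F.map_one, G.map_one]
  map_comp g o p := by rw [F.map_comp, G.map_comp]; rfl

/-- The category of colours and unary operations of an operad. -/
def UnaryCat (P : SetOperad.{w, u}) : Type u := P.Col

instance (P : SetOperad.{w, u}) : Category.{w} P.UnaryCat where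
  Hom x y := P.Op (fun _ : Fin 1 => x) y
  id x := P.one x
  comp p q := P.unaryComp q p
  id_comp p := P.unaryComp_one p
  comp_id p := P.one_unaryComp p
  assoc p q r := (P.unaryComp_assoc r q p).symm

end SetOperad

/-! ### The relations of the AQFT operad, read in a target operad -/

section

variable {C : Type u} [Category.{v} C] {orth : Orthogonality C} {P : SetOperad.{w', u'}}

namespace SetOperad.Map

variable (F : Map (setOperad orth) P)

/-- The functor given by the unary operations `act f`. -/
def functor : C ⥤ P.UnaryCat where
  obj x := F.col x
  map f := F.op (Quot.mk _ (Term.act f))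
  map_id x := (congrArg F.op (Quot.sound (Rel.act_id x))).trans (F.map_one x)
  map_comp f g := (congrArg F.op (Quot.sound (Rel.act_comp f g))).symm.trans 
    (F.map_comp _ (Quot.mk _ (Term.act g)) (Quot.mk _ (Term.act f)))

/-- The image of `act f`. -/
def act {x y : C} (f : x ⟶ y) : P.Op (fun _ : Fin 1 => F.col x) (F.col y) :=
  F.op (Quot.mk _ (Term.act f))

/-- The image of `mul d`. -/
def mul (d : C) : P.Op (fun _ : Fin 2 => F.col d) (F.col d) :=
  F.op (Quot.mk _ (Term.mul d))

/-- The image of `unit c d`. -/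
def unit (c : Fin 0 → C) (d : C) : P.Op (fun i => F.col (c i)) (F.col d) :=
  F.op (Quot.mk _ (Term.unit c d))

lemma op_comp {n m k : ℕ} {c : Fin n → C} {x : C} {b : Fin m → C} {a : Fin k → C} {d : C}
    (g : Graft c x b a) (o : Term c d) (p : Term b x) :
    F.op (Quot.mk (Rel orth) (Term.comp g o p)) =
      P.comp (g.map F.col) (F.op (Quot.mk _ o)) (F.op (Quot.mk _ p)) :=
  F.map_comp g (Quot.mk _ o) (Quot.mk _ p)

lemma act_unit {x y : C} (f : x ⟶ y) (c : Fin 0 → C) :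
    P.postId (F.act f) (F.unit c x) = F.unit c y := by
  have H := congrArg F.op (Quot.sound (Rel.act_unit (orth := orth) f c
    (Graft.post x (Equiv.refl _) (fun j => congrArg c (Equiv.refl_apply j)))))
  rw [op_comp, P.comp_eq_postId _ (fun j => rfl)] at H
  exact H

lemma act_mul {x y : C} (f : x ⟶ y) :
    P.postId (F.act f) (F.mul x) =
      P.plugTwo (c := fun _ => F.col y) (a := fun _ => F.col x) rfl rfl rfl rfl (F.mul y)
        (F.act f) (F.act f) := by
  let r : Fin 2 → C := fun j => if j = 0 then x else y
  let h : Graft (fun _ : Fin 2 => y) y (fun _ : Fin 1 => x) r :=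
    Graft.plug 0 rfl (if_pos rfl) (fun s hs => if_neg hs)
  let h' : Graft r y (fun _ : Fin 1 => x) (fun _ : Fin 2 => x) :=
    Graft.plug 1 (if_neg (by decide)) rfl (by simp [Fin.forall_fin_two, r])
  have hh : h.PlugBoth h' 0 1 := ⟨rfl, ⟨by simp [h], rfl⟩, ⟨by simp [h, h'], rfl⟩, rfl⟩
  have H := congrArg F.op (Quot.sound (Rel.act_mul (orth := orth) f
    (Graft.post x (Equiv.refl _) (fun _ => rfl)) (fun _ => rfl) h h' hh))
  rw [op_comp, P.comp_eq_postId _ (fun j => rfl), op_comp, op_comp] at H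
  exact H.trans (P.comp_comp_eq_plugTwo (h := h.map F.col) (h' := h'.map F.col) hh rfl rfl
    (F.mul y) (F.act f) (F.act f))

lemma act_comm {x y d : C} (f : x ⟶ d) (f' : y ⟶ d) (hf : orth.rel f f') :
    P.Commute (F.mul d) (F.act f) (F.act f') := by
  let a : Fin 2 → C := fun j => if j = 0 then x else y
  let r : Fin 2 → C := fun j => if j = 0 then x else d
  let g : Graft (fun _ : Fin 2 => d) d (fun _ : Fin 1 => x) r :=
    Graft.plug 0 rfl (if_pos rfl) (fun s hs => if_neg hs)
  let g' : Graft r d (fun _ : Fin 1 => y) a :=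
    Graft.plug 1 (if_neg (by decide)) (if_neg (by decide)) (by simp [Fin.forall_fin_two, r, a])
  have hg : g.PlugBoth g' 0 1 := ⟨rfl, ⟨by simp [g], rfl⟩, ⟨by simp [g, g'], rfl⟩, rfl⟩
  let r' : Fin 2 → C := fun j => if j = 1 then x else d
  let t : Fin 2 → C := fun j => if j = 0 then y else x
  let h : Graft (fun _ : Fin 2 => d) d (fun _ : Fin 1 => x) r' :=
    Graft.plug 1 rfl (if_pos rfl) (fun s hs => if_neg hs)
  let k : Graft r' d (fun _ : Fin 1 => y) t :=
    Graft.plug 0 (if_neg (by decide)) (if_pos rfl) (by simp [Fin.forall_fin_two, r', t])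
  -- Without renumbering, the input of `f'` would be number `0`; `PlugBoth` wants the input of `f`
  -- first, whence the swap.
  let h' : Graft r' d (fun _ : Fin 1 => y) a :=
    k.renumber (Equiv.swap 0 1) (by simp [Fin.forall_fin_two, t, a])
  have hh : h.PlugBoth h' 1 0 :=
    ⟨rfl, ⟨by simp [h], rfl⟩, ⟨by simp [h, h', k], rfl⟩, rfl⟩
  have H := congrArg F.op (Quot.sound (Rel.comm (orth := orth) f f' hf g g' hg h h' hh))
  rw [op_comp, op_comp, op_comp, op_comp] at H
  have H₁ := P.comp_comp_eq_plugTwo (h := g.map F.col) (h' := g'.map F.col) hg rfl rfl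
    (F.mul d) (F.act f) (F.act f')
  have H₂ := P.comp_comp_eq_plugTwo_swap (h := h.map F.col) (h' := h'.map F.col) hh rfl rfl
    (F.mul d) (F.act f) (F.act f')
  exact P.plugTwo_eq_of_eq rfl rfl _ _ rfl rfl ((H₁.symm.trans H).trans H₂)

end SetOperad.Map

/-! ### Extension to the localized orthogonal category -/

variable {S : MorphismProperty C}

open Localization.Construction

namespace SetOperad.Map

variable (F : Map (setOperad orth) P) (hF : S.IsInvertedBy F.functor)

/-- The unary operation of `P` given by a morphism in the localized category. -/
noncomputable def liftAct {X Y : S.Localization} (f : X ⟶ Y) :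
    P.Op (fun _ : Fin 1 => F.col X.as.obj) (F.col Y.as.obj) :=
  (lift F.functor hF).map f

lemma liftAct_id (X : S.Localization) : F.liftAct hF (𝟙 X) = P.one (F.col X.as.obj) :=
  (lift F.functor hF).map_id X

lemma liftAct_comp {X Y Z : S.Localization} (f : X ⟶ Y) (g : Y ⟶ Z) :
    F.liftAct hF (f ≫ g) = P.unaryComp (F.liftAct hF g) (F.liftAct hF f) :=
  (lift F.functor hF).map_comp f g

lemma liftAct_Q {x y : C} (f : x ⟶ y) : F.liftAct hF (S.Q.map f) = F.act f := by
  -- The transports from the equality of functors are identities by definition, because the objects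
  -- agree definitionally.
  exact (Functor.congr_hom (fac F.functor hF) f).trans
    ((Category.id_comp _).trans (Category.comp_id _))

/-- The localized category is generated under composition by the image of `C` and the formal
inverses of `S`. The predicate concerns operations of `P`, so closure under inverses can be checked
for any mutually inverse pair there. -/
lemma liftAct_induction (p : ∀ {X Y : C}, P.Op (fun _ : Fin 1 => F.col X) (F.col Y) → Prop)
    (act : ∀ {x y : C} (f : x ⟶ y), p (F.act f))
    (comp : ∀ {x y z : C} (q : P.Op (fun _ : Fin 1 => F.col y) (F.col z))
      (r : P.Op (fun _ : Fin 1 => F.col x) (F.col y)), p q → p r → p (P.unaryComp q r))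
    (inv : ∀ {x y : C} (q : P.Op (fun _ : Fin 1 => F.col x) (F.col y))
      (r : P.Op (fun _ : Fin 1 => F.col y) (F.col x)), P.unaryComp r q = P.one _ →
      P.unaryComp q r = P.one _ → p q → p r)
    {X Y : S.Localization} (f : X ⟶ Y) : p (F.liftAct hF f) := by
  let Φ : MorphismProperty S.Localization := fun X Y f => p (F.liftAct hF f)
  have : Φ.IsStableUnderComposition := ⟨fun f g hf hg => by
    simp only [Φ, liftAct_comp]
    exact comp _ _ hg hf⟩
  have hQ : ∀ ⦃X Y : C⦄ (f : X ⟶ Y), Φ (S.Q.map f) := fun X Y f => by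
    simp only [Φ]
    rw [liftAct_Q]
    exact act f
  have H := morphismProperty_eq_top Φ hQ fun X Y w hw => by
    refine inv (F.liftAct hF (S.Q.map w)) _ ?_ ?_ (hQ w)
    · rw [← liftAct_comp, ← liftAct_id]
      exact congrArg _ (wIso w hw).hom_inv_id
    · rw [← liftAct_comp, ← liftAct_id]
      exact congrArg _ (wIso w hw).inv_hom_id
  change Φ f
  rw [H]
  trivial

lemma liftAct_unit {X Y : S.Localization} (f : X ⟶ Y) (c : Fin 0 → C) :
    P.postId (F.liftAct hF f) (F.unit c X.as.obj) = F.unit c Y.as.obj := by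
  refine F.liftAct_induction hF
    (fun {X Y} q => P.postId q (F.unit c X) = F.unit c Y) ?_ ?_ ?_ f
  · exact fun f => F.act_unit f c
  · intro x y z q r hq hr
    rw [← P.postId_postId, hr, hq]
  · intro x y q r h _ hq
    rw [← hq, P.postId_postId, h, P.one_postId]

lemma liftAct_mul {X Y : S.Localization} (f : X ⟶ Y) :
    P.postId (F.liftAct hF f) (F.mul X.as.obj) =
      P.plugTwo (c := fun _ => F.col Y.as.obj) (a := fun _ => F.col X.as.obj) rfl rfl rfl rfl
        (F.mul Y.as.obj) (F.liftAct hF f) (F.liftAct hF f) := by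
  refine F.liftAct_induction hF (fun {X Y} q => P.postId q (F.mul X) =
    P.plugTwo (c := fun _ => F.col Y) (a := fun _ => F.col X) rfl rfl rfl rfl
      (F.mul Y) q q) ?_ ?_ ?_ f
  · exact fun f => F.act_mul f
  · intro x y z q r hq hr
    rw [← P.postId_postId, hr, ← P.plugTwo_postId, hq, P.plugTwo_plugTwo]
  · intro x y q r h h' hq
    -- The inverse of a multiplicative isomorphism is multiplicative: `q ∘ mul x = mul y ∘ (q, q)`
    -- is precomposed with `(r, r)`, then postcomposed with `r`.
    have H : F.mul y = P.plugTwo (c := fun _ => F.col x) (a := fun _ => F.col y) rfl rfl rfl rfl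
        (P.postId q (F.mul x)) r r := by
      rw [hq, P.plugTwo_plugTwo, h', P.plugTwo_one]
    rw [H, ← P.plugTwo_postId, P.postId_postId, h, P.one_postId]

/-- Induction on the generation of the pushforward relation. Both orders are proved together, which
makes the symmetry case immediate. -/
lemma liftAct_commute {X Y Z : S.Localization} {f : X ⟶ Z} {g : Y ⟶ Z}
    (h : (orth.localization S).rel f g) :
    P.Commute (F.mul Z.as.obj) (F.liftAct hF f) (F.liftAct hF g) ∧
      P.Commute (F.mul Z.as.obj) (F.liftAct hF g) (F.liftAct hF f) := by
  change Orthogonality.PushforwardRel orth S.Q f g at h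
  induction h with
  | map f g h =>
    rw [liftAct_Q, liftAct_Q]
    exact ⟨F.act_comm f g h, F.act_comm g f (orth.symm h)⟩
  | symm f g _ ih => exact ih.symm
  | post f g k _ ih =>
    rw [liftAct_comp, liftAct_comp]
    exact ⟨ih.1.post (F.liftAct_mul hF k), ih.2.post (F.liftAct_mul hF k)⟩
  | pre f g k l _ ih =>
    rw [liftAct_comp, liftAct_comp]
    exact ⟨ih.1.pre _ _, ih.2.pre _ _⟩

/-- The operation of `P` given by a term in the generators of the operad of the localized
orthogonal category. -/
noncomputable def liftTerm : ∀ {n : ℕ} {c : Fin n → S.Localization} {d : S.Localization},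
    Term c d → P.Op (fun i => F.col (c i).as.obj) (F.col d.as.obj)
  | _, _, _, .act f => F.liftAct hF f
  | _, _, _, .mul d => F.mul d.as.obj
  | _, _, _, .unit c d => F.unit (fun i => (c i).as.obj) d.as.obj
  | _, _, _, .one d => P.one (F.col d.as.obj)
  | _, _, _, .comp g o p =>
    P.comp (g.map fun X : S.Localization => F.col X.as.obj) (liftTerm o) (liftTerm p)

lemma liftTerm_eq {n : ℕ} {c : Fin n → S.Localization} {d : S.Localization} {o p : Term c d}
    (H : Rel (orth.localization S) o p) : F.liftTerm hF o = F.liftTerm hF p := by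
  induction H with
  | refl o => rfl
  | symm _ ih => exact ih.symm
  | trans _ _ ih ih' => exact ih.trans ih'
  | comp g _ _ ih ih' => exact congrArg₂ (P.comp _) ih ih'
  | one_comp g hg p => exact P.one_comp _ hg _
  | comp_one g hg hg' o => exact P.comp_one (g.map _) hg hg' _
  | sequential g g' h h' H o p q =>
    exact P.sequential (g.map _) (g'.map _) (h.map _) (h'.map _) H _ _ _
  | parallel g g' h h' H o p q =>
    exact P.parallel (g.map _) (g'.map _) (h.map _) (h'.map _) H _ _ _
  | act_id x => exact F.liftAct_id hF x
  | act_comp f f' => exact (F.liftAct_comp hF f f').symm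
  | mul_unit d c g =>
    have H := congrArg F.op (Quot.sound (Rel.mul_unit (orth := orth) d.as.obj
      (fun i => (c i).as.obj) (g.map fun X => X.as.obj)))
    rw [op_comp] at H
    exact H.trans (F.map_one _)
  | mul_assoc d g h hg hh =>
    have H := congrArg F.op (Quot.sound (Rel.mul_assoc (orth := orth) d.as.obj
      (g.map fun X => X.as.obj) (h.map fun X => X.as.obj) hg hh))
    rw [op_comp, op_comp] at H
    exact H
  | act_unit f c g =>
    refine Eq.trans ?_ (F.liftAct_unit hF f fun i => (c i).as.obj)
    exact P.comp_eq_postId _ (fun j => j.elim0) _ _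
  | act_mul f g hg h h' hh =>
    refine (P.comp_eq_postId _ hg _ _).trans ((F.liftAct_mul hF f).trans ?_)
    exact (P.comp_comp_eq_plugTwo (h := h.map fun X : S.Localization => F.col X.as.obj)
      (h' := h'.map fun X : S.Localization => F.col X.as.obj) hh rfl rfl _ _ _).symm
  | comm f f' hf g g' hg h h' hh =>
    let φ : S.Localization → P.Col := fun X => F.col X.as.obj
    have hx := congrArg φ hg.col_zero
    have hy := congrArg φ hg.col_one
    refine (P.comp_comp_eq_plugTwo (h := g.map φ) (h' := g'.map φ) hg hx hy _ _ _).trans ?_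
    refine Eq.trans ?_
      (P.comp_comp_eq_plugTwo_swap (h := h.map φ) (h' := h'.map φ) hh hx hy _ _ _).symm
    exact P.plugTwo_eq_of_eq (c := fun _ => _) rfl rfl _ _ hx hy (F.liftAct_commute hF hf).1

/-- The extension of a morphism which inverts `S` to the operad of the localized orthogonal
category. -/
noncomputable def lift : Map (setOperad (orth.localization S)) P where
  col X := F.col X.as.obj
  op := Quot.lift (F.liftTerm hF) fun _ _ => F.liftTerm_eq hF
  map_one _ := rfl
  map_comp g o p := by
    induction o using Quot.ind
    induction p using Quot.ind
    rfl

lemma liftTerm_map {n : ℕ} {c : Fin n → C} {d : C} (o : Term c d) :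
    F.liftTerm hF (o.map S.Q) = F.op (Quot.mk _ o) := by
  induction o with
  | act f => exact F.liftAct_Q hF f
  | mul d => rfl
  | unit c d => rfl
  | one d => exact (F.map_one d).symm
  | comp g o p ih ih' =>
    rw [op_comp, ← ih, ← ih']
    rfl

lemma compMap_lift : (setOperadToLocalization orth S).compMap (F.lift hF) = F := by
  have H : ∀ {n : ℕ} {c : Fin n → C} {d : C} (o : (setOperad orth).Op c d),
      ((setOperadToLocalization orth S).compMap (F.lift hF)).op o = F.op o := fun o => by
    induction o using Quot.ind
    exact F.liftTerm_map hF _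
  exact Map.ext' rfl fun o => heq_of_eq (H o)

/-- On unary generators this is uniqueness in the universal property of the localized category.
Every other generator of the localized operad is already the image of a generator over `C`. -/
lemma ext_of_compMap {G G' : Map (setOperad (orth.localization S)) P}
    (h : (setOperadToLocalization orth S).compMap G =
      (setOperadToLocalization orth S).compMap G') : G = G' := by
  have hf : G.functor = G'.functor := uniq _ _ (congrArg functor h)
  obtain ⟨φ, op, h₁, h₂⟩ := G
  obtain ⟨φ', op', h₁', h₂'⟩ := G'
  obtain rfl : φ = φ' := congrArg Functor.obj hf
  refine Map.ext' rfl fun o => heq_of_eq ?_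
  have hop : ∀ {n : ℕ} {c : Fin n → C} {d : C} (o : Term c d),
      op (Quot.mk (Rel (orth.localization S)) (o.map S.Q)) = op' (Quot.mk _ (o.map S.Q)) := by
    intro n c d o
    have := eq_of_heq (Map.mk.inj h).2
    exact congrFun (congrFun (congrFun (congrFun this n) c) d) (Quot.mk _ o)
  induction o using Quot.ind with | mk o
  dsimp only
  induction o with
  | act f =>
    exact (Functor.congr_hom hf f).trans ((Category.id_comp _).trans (Category.comp_id _))
  -- An object `d` of the localized category is definitionally `S.Q.obj d.as.obj`.
  | mul d => exact hop (Term.mul d.as.obj)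
  | unit c d => exact hop (Term.unit (fun i => (c i).as.obj) d.as.obj)
  | one d => exact (h₁ d).trans (h₁' d).symm
  | comp g o p ih ih' =>
    refine (h₂ g (Quot.mk _ o) (Quot.mk _ p)).trans (Eq.trans ?_
      (h₂' g (Quot.mk _ o) (Quot.mk _ p)).symm)
    exact congrArg₂ (P.comp _) ih ih'

end SetOperad.Map

end

/-! ### Points of an operad in `V`, and the adjunction with `ofSet` -/

section

variable {V : Type u'} [Category.{v'} V] [MonoidalCategory V] [SymmetricCategory V]

namespace VOperad

/-- Separates the three points from the two composition maps of an iterated composite, so that the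
associativity laws of an operad in `V` apply to the latter. -/
lemma point_comp_left {A B X Y Z : V} (o : 𝟙_ V ⟶ A) (p : 𝟙_ V ⟶ B) (q : 𝟙_ V ⟶ X)
    (φ : A ⊗ B ⟶ Y) (ψ : Y ⊗ X ⟶ Z) :
    (λ_ (𝟙_ V)).inv ≫ (((λ_ (𝟙_ V)).inv ≫ (o ⊗ₘ p) ≫ φ) ⊗ₘ q) ≫ ψ =
      (λ_ (𝟙_ V)).inv ≫ (λ_ (𝟙_ V)).inv ▷ 𝟙_ V ≫ ((o ⊗ₘ p) ⊗ₘ q) ≫ φ ▷ X ≫ ψ := by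
  rw [← tensorHom_id, ← tensorHom_id, tensorHom_comp_tensorHom_assoc,
    tensorHom_comp_tensorHom_assoc, Category.id_comp, Category.comp_id, Category.assoc]

lemma point_comp_right {A B X Y Z : V} (o : 𝟙_ V ⟶ A) (p : 𝟙_ V ⟶ B) (q : 𝟙_ V ⟶ X)
    (φ : B ⊗ X ⟶ Y) (ψ : A ⊗ Y ⟶ Z) :
    (λ_ (𝟙_ V)).inv ≫ (o ⊗ₘ ((λ_ (𝟙_ V)).inv ≫ (p ⊗ₘ q) ≫ φ)) ≫ ψ =
      (λ_ (𝟙_ V)).inv ≫ 𝟙_ V ◁ (λ_ (𝟙_ V)).inv ≫ (o ⊗ₘ (p ⊗ₘ q)) ≫ A ◁ φ ≫ ψ := by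
  rw [← id_tensorHom, ← id_tensorHom, tensorHom_comp_tensorHom_assoc,
    tensorHom_comp_tensorHom_assoc, Category.id_comp, Category.comp_id, Category.assoc]

variable (P : VOperad.{u} V)

/-- The operad in sets of points of an operad in `V`. -/
def points : SetOperad.{v', u} where
  Col := P.Col
  Op c d := 𝟙_ V ⟶ P.Op c d
  one x := P.one x
  comp g o p := (λ_ (𝟙_ V)).inv ≫ (o ⊗ₘ p) ≫ P.comp g
  one_comp g hg p := by
    rw [tensorHom_def'_assoc, P.one_comp g hg, leftUnitor_naturality, Iso.inv_hom_id_assoc]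
  comp_one g hg hg' o := by
    rw [tensorHom_def_assoc, P.comp_one g hg hg', rightUnitor_naturality, ← unitors_equal,
      Iso.inv_hom_id_assoc]
  sequential g g' h h' H o p q := by
    rw [point_comp_left, P.sequential g g' h h' H, point_comp_right,
      associator_naturality_assoc]
    monoidal
  parallel g g' h h' H o p q := by
    -- By naturality the braiding moves past the points and becomes the braiding of two copies of
    -- the unit, which is built from unitors; only monoidal coherence is left.
    rw [point_comp_left, P.parallel g g' h h' H, point_comp_left, associator_naturality_assoc,
      ← id_tensorHom, tensorHom_comp_tensorHom_assoc, BraidedCategory.braiding_naturality,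
      Category.comp_id, ← Category.id_comp o, ← tensorHom_comp_tensorHom_assoc,
      associator_inv_naturality_assoc, braiding_tensorUnit_left, Category.id_comp]
    monoidal

variable {P}

variable [MonoidalClosed V] [HasCoproducts.{w} V] {O : SetOperad.{w, u}}

/-- The action on points of a morphism of operads in `V`. -/
noncomputable def Hom.toMap (F : ofSet V O ⟶ P) : SetOperad.Map O P.points where
  col := Hom.col F
  op o := point o ≫ Hom.op F _ _
  map_one x := Hom.map_one F x
  map_comp {n m k c x b a d} g o p := by
    have H := Hom.map_comp F g (d := d)
    have H' := point_copowerMap₂ (V := V) (O.comp g) o p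
    change point (O.comp g o p) ≫ Hom.op F a d =
      (λ_ (𝟙_ V)).inv ≫ ((point o ≫ Hom.op F c d) ⊗ₘ (point p ≫ Hom.op F b x)) ≫ P.comp _
    refine Eq.trans ?_ (congrArg ((λ_ (𝟙_ V)).inv ≫ ·) (tensorHom_comp_tensorHom_assoc
      (point o) (point p) (Hom.op F c d) (Hom.op F b x) (P.comp (g.map (Hom.col F)))))
    refine Eq.trans ?_ (congrArg (fun t => (λ_ (𝟙_ V)).inv ≫ (point o ⊗ₘ point p) ≫ t) H)
    refine Eq.trans ?_ (congrArg (fun t => (λ_ (𝟙_ V)).inv ≫ t) (Category.assoc _ _ _))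
    refine Eq.trans ?_ (congrArg (fun t => (λ_ (𝟙_ V)).inv ≫ t ≫ Hom.op F a d) H').symm
    exact (Iso.inv_hom_id_assoc _ _).symm.trans
      (congrArg ((λ_ (𝟙_ V)).inv ≫ ·) (Category.assoc _ _ _).symm)

/-- The morphism of operads in `V` given by its action on points. -/
noncomputable def ofMap (F : SetOperad.Map O P.points) : ofSet V O ⟶ P where
  col := F.col
  op _ _ := copowerDesc fun o => F.op o
  map_one x := (point_copowerDesc _ _).trans (F.map_one x)
  map_comp g := by
    apply copower_hom_ext₂
    intro o p
    change _ ≫ copowerMap₂ _ ≫ copowerDesc _ = _ ≫ (copowerDesc _ ⊗ₘ copowerDesc _) ≫ _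
    rw [← Category.assoc, point_copowerMap₂, Category.assoc, tensorHom_comp_tensorHom_assoc]
    refine (congrArg ((λ_ (𝟙_ V)).hom ≫ ·)
      ((point_copowerDesc _ _).trans (F.map_comp g o p))).trans ?_
    refine (Iso.hom_inv_id_assoc _ _).trans ?_
    exact congrArg₂ (fun s t => (s ⊗ₘ t) ≫ P.comp (g.map F.col))
      (point_copowerDesc (fun o => F.op o) o).symm (point_copowerDesc (fun o => F.op o) p).symm

lemma toMap_ofMap (F : SetOperad.Map O P.points) : (ofMap F).toMap = F :=
  SetOperad.Map.ext' rfl fun o => heq_of_eq (point_copowerDesc (fun o => F.op o) o)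

/-- A morphism out of a coproduct of units is determined by its restrictions to the points. -/
lemma toMap_injective {F G : ofSet V O ⟶ P} (h : Hom.toMap F = Hom.toMap G) : F = G := by
  obtain ⟨φ, op, h₁, h₂⟩ := F
  obtain ⟨φ', op', h₁', h₂'⟩ := G
  obtain rfl : φ = φ' := congrArg SetOperad.Map.col h
  have H := eq_of_heq (SetOperad.Map.mk.inj h).2
  refine Hom.ext rfl (heq_of_eq ?_)
  funext n c d
  apply copower_hom_ext
  intro o
  exact congrFun (congrFun (congrFun (congrFun H n) c) d) o

lemma toMap_comp {O' : SetOperad.{w, u}} (F : O.Hom O') (G : ofSet V O' ⟶ P) :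
    Hom.toMap (ofSetMap F ≫ G) = F.compMap (Hom.toMap G) := by
  refine SetOperad.Map.ext' rfl fun o => heq_of_eq ?_
  exact (Category.assoc _ _ _).symm.trans
    (congrArg (· ≫ Hom.op G _ _) (point_copowerDesc (fun o => point (F.op o)) o))

lemma compUnary_point {x y z : O.Col} (q : O.Op (fun _ : Fin 1 => y) z)
    (p : O.Op (fun _ : Fin 1 => x) y) :
    (ofSet V O).compUnary (point q) (point p) = point (O.unaryComp q p) := by
  have H := point_copowerMap₂ (V := V) (O.comp (Graft.unary x y)) q p
  exact (congrArg ((λ_ (𝟙_ V)).inv ≫ ·) H).trans (Iso.inv_hom_id_assoc _ _)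

lemma IsLocalization.existsUnique_iso {O O' O'' : VOperad.{u} V}
    {W : ∀ x y : O.Col, Set (O.Unary x y)} {L : O ⟶ O'} {L' : O ⟶ O''}
    (h : IsLocalization W L) (h' : IsLocalization W L') :
    ∃ e : O' ≅ O'', L ≫ e.hom = L' ∧ ∀ φ : O' ⟶ O'', L ≫ φ = L' → φ = e.hom := by
  obtain ⟨f, hf, hf'⟩ := h.2 O'' L' h'.1
  obtain ⟨g, hg, _⟩ := h'.2 O' L h.1
  refine ⟨⟨f, g, (h.2 O' L h.1).unique ?_ (Category.comp_id _),
    (h'.2 O'' L' h'.1).unique ?_ (Category.comp_id _)⟩, hf, hf'⟩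
  · rw [← Category.assoc, hf, hg]
  · rw [← Category.assoc, hg, hf]

end VOperad

end

/-! ### The localization theorem -/

section

variable {V : Type u'} [Category.{v'} V] [MonoidalCategory V] [SymmetricCategory V]
  [MonoidalClosed V] {C : Type u} [Category.{v} C] [HasCoproducts.{max u v} V]
  (orth : Orthogonality C) (S : MorphismProperty C)

lemma inverts_toAqftOperadLocalization :
    VOperad.Inverts (unaryOfMorphisms V orth S) (toAqftOperadLocalization V orth S) := by
  rintro x y _ ⟨f, hf, rfl⟩
  let act {X Y : S.Localization} (g : X ⟶ Y) :
      (setOperad (orth.localization S)).Op (fun _ : Fin 1 => X) Y := Quot.mk _ (Term.act g)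
  have act_comp {X Y Z : S.Localization} (g : X ⟶ Y) (g' : Y ⟶ Z) :
      (aqftOperadLocalization V orth S).compUnary (point (act g')) (point (act g)) =
        point (act (g ≫ g')) :=
    (VOperad.compUnary_point (act g') (act g)).trans
      (congrArg point (Quot.sound (Rel.act_comp g g')))
  have act_id (X : S.Localization) :
      point (act (𝟙 X)) = (aqftOperadLocalization V orth S).one X :=
    congrArg point (Quot.sound (Rel.act_id X))
  have H : VOperad.Hom.unary (toAqftOperadLocalization V orth S)
      (point (Quot.mk (Rel orth) (Term.act f))) = point (act (S.Q.map f)) :=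
    point_copowerDesc _ _
  let e := Localization.Construction.wIso f hf
  refine H ▸ ⟨point (act e.inv), ?_, ?_⟩
  · exact (act_comp e.hom e.inv).trans
      ((congrArg (fun t => point (act t)) e.hom_inv_id).trans (act_id _))
  · exact (act_comp e.inv e.hom).trans
      ((congrArg (fun t => point (act t)) e.inv_hom_id).trans (act_id _))

lemma isInvertedBy_functor_of_inverts {P : VOperad.{u} V} (F : aqftOperad V orth ⟶ P)
    (hF : VOperad.Inverts (unaryOfMorphisms V orth S) F) :
    S.IsInvertedBy (SetOperad.Map.functor (orth := orth) (VOperad.Hom.toMap F)) := by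
  intro x y f hf
  obtain ⟨q, hq, hq'⟩ := hF x y _ ⟨f, hf, rfl⟩
  -- An inverse of a unary operation of `P` is literally an inverse in the category of unary
  -- operations of `P.points`.
  exact ⟨q, hq, hq'⟩

lemma isLocalization_toAqftOperadLocalization :
    VOperad.IsLocalization (unaryOfMorphisms V orth S) (toAqftOperadLocalization V orth S) := by
  refine ⟨inverts_toAqftOperadLocalization orth S, fun P F hF => ?_⟩
  let F' : SetOperad.Map (setOperad orth) P.points := VOperad.Hom.toMap F
  have hF' : S.IsInvertedBy F'.functor := isInvertedBy_functor_of_inverts orth S F hF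
  -- The factorization is the extension in sets, carried back to `V`; equalities are tested on
  -- points.
  have key : toAqftOperadLocalization V orth S ≫ VOperad.ofMap (F'.lift hF') = F := by
    apply VOperad.toMap_injective
    refine (VOperad.toMap_comp _ _).trans ?_
    rw [VOperad.toMap_ofMap]
    exact F'.compMap_lift hF'
  refine ⟨_, key, fun G hG => ?_⟩
  apply VOperad.toMap_injective
  apply SetOperad.Map.ext_of_compMap
  exact (VOperad.toMap_comp _ _).symm.trans
    ((congrArg VOperad.Hom.toMap (hG.trans key.symm)).trans (VOperad.toMap_comp _ _))

end

end AQFT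

theorem mainTheorem6 {V : Type u'} [Category.{v'} V] [MonoidalCategory V] [SymmetricCategory V]
    [MonoidalClosed V] {C : Type u} [Category.{v} C] [HasCoproducts.{max u v} V]
    (orth : AQFT.Orthogonality C) (S : MorphismProperty C) :
    AQFT.VOperad.IsLocalization (AQFT.unaryOfMorphisms V orth S)
        (AQFT.toAqftOperadLocalization V orth S) ∧
      ∀ (O' : AQFT.VOperad.{u} V) (L : AQFT.aqftOperad V orth ⟶ O'),
        AQFT.VOperad.IsLocalization (AQFT.unaryOfMorphisms V orth S) L →
          ∃ e : O' ≅ AQFT.aqftOperadLocalization V orth S,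
            L ≫ e.hom = AQFT.toAqftOperadLocalization V orth S ∧
              ∀ φ : O' ⟶ AQFT.aqftOperadLocalization V orth S,
                L ≫ φ = AQFT.toAqftOperadLocalization V orth S → φ = e.hom :=
  ⟨AQFT.isLocalization_toAqftOperadLocalization orth S, fun _ _ h =>
    h.existsUnique_iso (AQFT.isLocalization_toAqftOperadLocalization orth S)⟩
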